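/- **Setting.** Let $P$ be a topological space, let $n,l_1,l_2\ge 0$ be integers, $l=l_1+l_2$, and let all spaces $\mathbb R^d$ carry the Euclidean norm. Let $g=(g_1,g_2):P\times\mathbb R^n\to\mathbb R^{l_1}\times\mathbb R^{l_2}=\mathbb R^l$, let $C_i\subset\mathbb R^{l_i}$ $(i=1,2)$ and $C=C_1\times C_2$, and let $(\bar p,\bar x)\in P\times\mathbb R^n$ satisfy $g(\bar p,\bar x)\in C$. Assume that $C_i$ is locally closed around $g_i(\bar p,\bar x)$ for $i=1,2$ (that is, $C_i\cap B$ is closed for some closed ball $B$ of positive radius centered at $g_i(\bar p,\bar x)$), that there are neighborhoods $U$ of $\bar x$ and $V$ of $\bar p$ such that $g(p,\cdot)$ is continuously differentiable on $U$ for each $p\in V$, and that both $g$ and its partial derivative $\nabla_xg$ are continuous at $(\bar p,\bar x)$. Let $\zeta:P\to\mathbb R$ be continuous at $\bar p$. **Notation.** $t_k\downarrow0$ means $t_k>0$ and $t_k\to0$. For $\Omega\subset\mathbb R^d$, $z\in\Omega$ and $w\in\mathbb R^d$ put $$T_\Omega(z)=\{u\mid \exists\,t_k\downarrow0,\ u_k\to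 u:\ z+t_ku_k\in\Omega\ \forall k\},\qquad \widehat N_\Omega(z)=\{v\mid\langle v,u\rangle\le0\ \ \forall u\in T_\Omega(z)\},$$ $$N_\Omega(z;w)=\{v\mid\exists\,t_k\downarrow0,\ w_k\to w,\ v_k\to v:\ z+t_kw_k\in\Omega,\ v_k\in\widehat N_\Omega(z+t_kw_k)\ \forall k\}.$$ The *image derivative* $D$ of $g$ in $p$ at $(\bar p,\bar x)$ (with respect to $\zeta$) is the closed (not necessarily convex) cone generated by $0$ and all $v\in\mathbb R^l$ for which there is a sequence $p_k\in P$, $k=1,2,\dots$, such that $g(p_k,\cdot)$ is differentiable at $\bar x$ and $$0<\|g(p_k,\bar x)-g(\bar p,\bar x)\|<\tfrac1k,\quad \|\nabla_xg(p_k,\bar x)-\nabla_xg(\bar p,\bar x)\|<\tfrac1k,\quad|\zeta(p_k)-\zeta(\bar p)|<\tfrac1k\quad\text{for all }k,$$ $$v=\lim_{k\to\infty}\frac{g(p_k,\bar x)-g(\bar p,\bar x)}{\|g(p_k,\bar x)-g(\bar p,\bar x)\|}.$$ For $h:P\times\mathbb R^n\to\mathbb R^m$ and $K\subset\mathbb R^m$,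 *Robinson stability* of the system $h(p,x)\in K$ at $(\bar p,\bar x)$ means that there are $\kappa\in[0,\infty)$ and neighborhoods $V$ of $\bar p$ and $U$ of $\bar x$ such that $$\operatorname{dist}\big(x;\{\xi\in\mathbb R^n\mid h(p,\xi)\in K\}\big)\le\kappa\operatorname{dist}\big(h(p,x);K\big)\quad\text{for all }(p,x)\in V\times U,$$ where $\operatorname{dist}(x;\emptyset)=\infty$. **Theorem.** Assume in addition that: 1. for every $v\in D$ and every sequence $t_k\downarrow0$ there is $u\in\mathbb R^n$ with $$\liminf_{k\to\infty}\frac{\operatorname{dist}\big(g(\bar p,\bar x)+t_k(v+\nabla_xg(\bar p,\bar x)u);C\big)}{t_k}=0;$$ 2. Robinson stability holds at $(\bar p,\bar x)$ for the system $g_2(p,x)\in C_2$; 3. for every $(0,0)\ne(v,u)\in D\times\mathbb R^n$, $v=(v_1,v_2)\in\mathbb R^{l_1}\times\mathbb R^{l_2}$, with $v+\nabla_xg(\bar p,\bar x)u\in T_C(g(\bar p,\bar x))$, and every $\lambda=(\lambda^1,\lambda^2)\in\mathbb R^{l_1}\times\mathbb R^{l_2}$, one has $$\Big[\lambda^i\in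 N_{C_i}\big(g_i(\bar p,\bar x);v_i+\nabla_xg_i(\bar p,\bar x)u\big)\ (i=1,2),\quad \nabla_xg(\bar p,\bar x)^*\lambda=0\Big]\ \Longrightarrow\ \lambda^1=0.$$ Then Robinson stability holds at $(\bar p,\bar x)$ for the whole system $g(p,x)\in C$. -/

import Mathlib

open Filter Topology
open scoped NNReal ENNReal

noncomputable section

/-- Local closedness of `Ω` around `z`: some closed ball around `z` meets `Ω` in a closed set. -/
def LocallyClosedAround {F : Type*} [NormedAddCommGroup F] (Ω : Set F) (z : F) : Prop :=
  ∃ r : ℝ, 0 < r ∧ IsClosed (Ω ∩ Metric.closedBall z r)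

/-- `t k ↓ 0`: a sequence of positive numbers tending to zero. -/
def DecreasesToZero (t : ℕ → ℝ) : Prop :=
  (∀ k, 0 < t k) ∧ Tendsto t atTop (𝓝 0)

/-- The Bouligand-Severi contingent cone `T_Ω(z)`. -/
def contingentCone {F : Type*} [NormedAddCommGroup F] [NormedSpace ℝ F]
    (Ω : Set F) (z : F) : Set F :=
  {u | ∃ (t : ℕ → ℝ) (w : ℕ → F), DecreasesToZero t ∧ Tendsto w atTop (𝓝 u) ∧
    ∀ k, z + t k • w k ∈ Ω}

/-- The Fréchet regular normal cone, the polar of the contingent cone (used at points of `Ω`). -/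
def regularNormalCone {F : Type*} [NormedAddCommGroup F] [InnerProductSpace ℝ F]
    (Ω : Set F) (z : F) : Set F :=
  {v | ∀ u ∈ contingentCone Ω z, inner ℝ v u ≤ 0}

/-- The limiting normal cone `N_Ω(z; w)` to `Ω` at `z` in direction `w`. -/
def directionalNormalCone {F : Type*} [NormedAddCommGroup F] [InnerProductSpace ℝ F]
    (Ω : Set F) (z w : F) : Set F :=
  {v | ∃ (t : ℕ → ℝ) (w' v' : ℕ → F), DecreasesToZero t ∧
    Tendsto w' atTop (𝓝 w) ∧ Tendsto v' atTop (𝓝 v) ∧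
    ∀ k, z + t k • w' k ∈ Ω ∧ v' k ∈ regularNormalCone Ω (z + t k • w' k)}

/-- The solution map `Γ(p) = {x | g(p, x) ∈ C}` of the parametric constraint system. -/
def solutionMap {P E F : Type*} (g : P → E → F) (C : Set F) (p : P) : Set E :=
  {x | g p x ∈ C}

/-- Robinson stability at `(pbar, xbar)` with modulus `κ`.
Distances are `ℝ≥0∞`-valued, so that the distance to the empty set is `∞`. -/
def RobinsonStableWith {P E F : Type*} [TopologicalSpace P] [NormedAddCommGroup E]
    [NormedAddCommGroup F] (κ : ℝ≥0) (g : P → E → F) (C : Set F) (pbar : P) (xbar : E) : Prop :=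
  ∃ U ∈ 𝓝 xbar, ∃ V ∈ 𝓝 pbar, ∀ p ∈ V, ∀ x ∈ U,
    Metric.infEDist x (solutionMap g C p) ≤ (κ : ℝ≥0∞) * Metric.infEDist (g p x) C

/-- Robinson stability at `(pbar, xbar)`: the estimate holds with some finite modulus. -/
def RobinsonStable {P E F : Type*} [TopologicalSpace P] [NormedAddCommGroup E]
    [NormedAddCommGroup F] (g : P → E → F) (C : Set F) (pbar : P) (xbar : E) : Prop :=
  ∃ κ : ℝ≥0, RobinsonStableWith κ g C pbar xbar

/-- Smoothness of `g` in the decision variable: for all `p` near `pbar` the map `g(p, ·)` is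
continuously differentiable on one (open) neighborhood of `xbar`, and both `g` and its partial
derivative in `x` are jointly continuous at `(pbar, xbar)`. -/
def PartiallySmoothAt {P E F : Type*} [TopologicalSpace P]
    [NormedAddCommGroup E] [NormedSpace ℝ E] [NormedAddCommGroup F] [NormedSpace ℝ F]
    (g : P → E → F) (pbar : P) (xbar : E) : Prop :=
  (∃ U : Set E, IsOpen U ∧ xbar ∈ U ∧ ∃ V ∈ 𝓝 pbar, ∀ p ∈ V, ContDiffOn ℝ 1 (g p) U) ∧
  ContinuousAt (fun q : P × E => g q.1 q.2) (pbar, xbar) ∧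
  ContinuousAt (fun q : P × E => fderiv ℝ (g q.1) q.2) (pbar, xbar)

/-- The unit vectors generating the image derivative: limits of normalized increments
`g(p_k, xbar) - g(pbar, xbar)` along sequences `p_k` in the parameter space. -/
def imageDirections {P E F : Type*}
    [NormedAddCommGroup E] [NormedSpace ℝ E] [NormedAddCommGroup F] [NormedSpace ℝ F]
    (g : P → E → F) (ζ : P → ℝ) (pbar : P) (xbar : E) : Set F :=
  {v | ∃ p : ℕ → P,
    (∀ k : ℕ,
      0 < ‖g (p k) xbar - g pbar xbar‖ ∧
      ‖g (p k) xbar - g pbar xbar‖ < 1 / ((k : ℝ) + 1) ∧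
      DifferentiableAt ℝ (g (p k)) xbar ∧
      ‖fderiv ℝ (g (p k)) xbar - fderiv ℝ (g pbar) xbar‖ < 1 / ((k : ℝ) + 1) ∧
      |ζ (p k) - ζ pbar| < 1 / ((k : ℝ) + 1)) ∧
    Tendsto (fun k => ‖g (p k) xbar - g pbar xbar‖⁻¹ • (g (p k) xbar - g pbar xbar))
      atTop (𝓝 v)}

/-- The image derivative of `g` in `p` at `(pbar, xbar)` with respect to `ζ`: the closed (not
necessarily convex) cone generated by `0` and the directions above. -/
def imageDerivative {P E F : Type*}
    [NormedAddCommGroup E] [NormedSpace ℝ E] [NormedAddCommGroup F] [NormedSpace ℝ F]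
    (g : P → E → F) (ζ : P → ℝ) (pbar : P) (xbar : E) : Set F :=
  closure {w | ∃ α : ℝ, 0 ≤ α ∧ ∃ v ∈ insert 0 (imageDirections g ζ pbar xbar), w = α • v}

/-- The map `(g₁, g₂)` with values in the Euclidean (`ℓ²`) product of the two image spaces. -/
def splitMap {P E F₁ F₂ : Type*} (g₁ : P → E → F₁) (g₂ : P → E → F₂) :
    P → E → WithLp 2 (F₁ × F₂) :=
  fun p x => WithLp.toLp 2 (g₁ p x, g₂ p x)

/-- The product set `C₁ × C₂` in the Euclidean (`ℓ²`) product. -/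
def splitSet {F₁ F₂ : Type*} (C₁ : Set F₁) (C₂ : Set F₂) : Set (WithLp 2 (F₁ × F₂)) :=
  {z | z.fst ∈ C₁ ∧ z.snd ∈ C₂}

end

/-! Argue by contradiction, turning the failure of stability into a nonzero multiplier. If the
estimate fails, then for every small `δ` there are `p` near `pbar` and `w` near `xbar` whose
distance to the feasible set is large compared with the residual. Stability of the second block
moves `w` to a point feasible for that block at a cost proportional to the residual. Minimizing the
distance of `g₁ p` to `C₁` plus a slope `δ` over points feasible for the second block then gives
`x₁`, still infeasible for `C₁`. The same stability makes the constraint an exact penalty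
(`exists_penalized_minimizer`). A smoothed version of this penalized problem yields regular normals
`a`, `b` at nearby points of `C₁`, `C₂` with `‖a‖ = 1`, `b` bounded, and stationarity up to a
multiple of `δ` (`exists_approximate_multipliers`).

Let `δ → 0` and rescale by `t = ‖x₁ - xbar‖ + ‖g(p, xbar) - g(pbar, xbar)‖`. The rescaled
displacements have norms summing to one, so they subconverge to a nonzero pair `(v, u)` with `v` in
the image derivative. For the multipliers to be directional normals, the normalized points of `C`
must converge to `v + A u`, where `A` is the derivative of `g(pbar, ·)` at `xbar`; this needs the
distance of `g₁ p x₁` to `C₁` to be `o(t)`. The first hypothesis supplies it: for this very sequence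
`t` it gives `u'` with `v + A u'` feasible to first order along a subsequence, and `xbar + t u'` is
a competitor in the penalized problem (`infDist_div_scale_le`). The limit multiplier is annihilated
by the adjoint of `A`, so the third hypothesis forces `a = 0`, contradicting `‖a‖ = 1`. -/

open Metric

/-! ### Localization of distances and normal cones; proximal normals -/

section Cones

variable {F : Type*} [NormedAddCommGroup F] [InnerProductSpace ℝ F]

/-- Points of `C` outside the ball lie farther from `q` than `c` does. This lets compact truncations
replace `C₁` and `C₂`. -/
theorem infDist_inter_closedBall_le {F : Type*} [PseudoMetricSpace F] {C : Set F} {c q : F} {r : ℝ}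
    (hc : c ∈ C) (hq : dist q c < r / 2) : infDist q (C ∩ closedBall c r) ≤ infDist q C := by
  have hr : 0 < r := by linarith [dist_nonneg (x := q) (y := c)]
  have hcK : c ∈ C ∩ closedBall c r := ⟨hc, mem_closedBall_self hr.le⟩
  refine le_of_forall_gt fun a ha => ?_
  obtain ⟨y, hy, hya⟩ := (infDist_lt_iff ⟨c, hc⟩).1 ha
  by_cases h : dist q y < r / 2
  · have hyK : y ∈ closedBall c r := by
      rw [mem_closedBall]
      linarith [dist_triangle y q c, dist_comm y q]
    exact (infDist_le_dist_of_mem (s := C ∩ closedBall c r) ⟨hy, hyK⟩).trans_lt hya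
  · exact (infDist_le_dist_of_mem hcK).trans_lt (by linarith)

theorem contingentCone_subset_inter_closedBall {C : Set F} {c y : F} {r : ℝ} (hy : y ∈ ball c r) :
    contingentCone C y ⊆ contingentCone (C ∩ closedBall c r) y := by
  rintro u ⟨t, w, ht, hw, hmem⟩
  have hlim : Tendsto (fun k => y + t k • w k) atTop (𝓝 y) := by
    simpa using (ht.2.smul hw).const_add y
  obtain ⟨N, hN⟩ := eventually_atTop.1 (hlim.eventually (isOpen_ball.mem_nhds hy))
  refine ⟨fun k => t (k + N), fun k => w (k + N),
    ⟨fun k => ht.1 _, (tendsto_add_atTop_iff_nat N).2 ht.2⟩,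
    (tendsto_add_atTop_iff_nat N).2 hw, fun k => ⟨hmem _, ball_subset_closedBall (hN _ ?_)⟩⟩
  omega

theorem regularNormalCone_inter_closedBall_subset {C : Set F} {c y : F} {r : ℝ}
    (hy : y ∈ ball c r) :
    regularNormalCone (C ∩ closedBall c r) y ⊆ regularNormalCone C y :=
  fun _ hv u hu => hv u (contingentCone_subset_inter_closedBall hy hu)

/-- Proximal normals are regular: expand the squared distance to `y + t k • w k`, divide by `t k`
and pass to the limit. -/
theorem smul_sub_mem_regularNormalCone {K : Set F} {q y : F} {a : ℝ} (ha : 0 ≤ a)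
    (hmin : ∀ y' ∈ K, ‖q - y‖ ≤ ‖q - y'‖) : a • (q - y) ∈ regularNormalCone K y := by
  rintro u ⟨t, w, ht, hw, hmem⟩
  rw [real_inner_smul_left]
  refine mul_nonpos_of_nonneg_of_nonpos ha ?_
  have h1 : Tendsto (fun k => inner ℝ (q - y) (w k)) atTop (𝓝 (inner ℝ (q - y) u)) :=
    tendsto_const_nhds.inner hw
  have h2 : Tendsto (fun k => t k * ‖w k‖ ^ 2 / 2) atTop (𝓝 0) := by
    simpa using (ht.2.mul (hw.norm.pow 2)).div_const 2
  refine le_of_tendsto_of_tendsto' h1 h2 fun k => ?_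
  have h3 := hmin _ (hmem k)
  have h4 : ‖q - y‖ ^ 2 ≤ ‖(q - y) - t k • w k‖ ^ 2 := by
    rw [sub_sub]; gcongr
  rw [norm_sub_sq_real (q - y), real_inner_smul_right, norm_smul, Real.norm_eq_abs, mul_pow, sq_abs] at h4
  have := ht.1 k
  have h5 : t k * (2 * inner ℝ (q - y) (w k)) ≤ t k * (t k * ‖w k‖ ^ 2) := by linarith
  linarith [le_of_mul_le_mul_left h5 this]

end Cones

/-! ### Fermat's rule with a slope, and the smoothed norm -/

section FirstOrder

variable {E F : Type*} [NormedAddCommGroup E] [NormedSpace ℝ E]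
  [NormedAddCommGroup F] [InnerProductSpace ℝ F]

theorem neg_le_of_forall_le_add_norm {f : E → ℝ} {f' : E →L[ℝ] ℝ} {x : E} {c : ℝ}
    (hf : HasFDerivAt f f' x) (h : ∀ᶠ x' in 𝓝 x, f x ≤ f x' + c * ‖x' - x‖) (d : E) :
    -(c * ‖d‖) ≤ f' d := by
  have hline : HasDerivAt (fun s : ℝ => x + s • d) d 0 := by
    simpa using ((hasDerivAt_id (0 : ℝ)).smul_const d).const_add x
  have hcomp : HasDerivAt (fun s : ℝ => f (x + s • d)) (f' d) 0 :=
    HasFDerivAt.comp_hasDerivAt (x := (0 : ℝ)) (f := fun s : ℝ => x + s • d) (l := f)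
      (l' := f') (by simpa using hf) hline
  have hs := hcomp.hasDerivWithinAt (s := Set.Ioi 0)
  rw [hasDerivWithinAt_iff_tendsto_slope' (by simp)] at hs
  refine ge_of_tendsto hs ?_
  have hcont : Tendsto (fun s : ℝ => x + s • d) (𝓝[>] 0) (𝓝 x) := by
    have := hline.continuousAt.tendsto
    simp only [zero_smul, add_zero] at this
    exact this.mono_left nhdsWithin_le_nhds
  filter_upwards [hcont.eventually h, self_mem_nhdsWithin] with s hs hs0
  have hs0 : 0 < s := hs0
  rw [slope_def_field, le_div_iff₀ (by simpa using hs0)]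
  simp only [add_sub_cancel_left, norm_smul, Real.norm_eq_abs, abs_of_pos hs0] at hs
  simp only [zero_smul, add_zero, sub_zero]
  linarith

/-- With `η ≠ 0` this is a norm smoothed so that `G x = z` is harmless; with `η = 0` it is the norm
itself away from `z`. Both cases are used. -/
theorem hasFDerivAt_sqrt_norm_sub_sq {G : E → F} {x : E} (hG : DifferentiableAt ℝ G x) (z : F)
    {η : ℝ} (hne : 0 < ‖G x - z‖ ^ 2 + η ^ 2) :
    ∃ f' : E →L[ℝ] ℝ, HasFDerivAt (fun x => √(‖G x - z‖ ^ 2 + η ^ 2)) f' x ∧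
      ∀ h, f' h = inner ℝ ((√(‖G x - z‖ ^ 2 + η ^ 2))⁻¹ • (G x - z)) (fderiv ℝ G x h) := by
  have h1 := (((hG.hasFDerivAt.sub_const z).norm_sq).add_const (η ^ 2)).sqrt hne.ne'
  refine ⟨_, h1, fun h => ?_⟩
  rw [real_inner_smul_left]
  simp only [_root_.smul_apply, ContinuousLinearMap.comp_apply, innerSL_apply_apply,
    smul_eq_mul, nsmul_eq_mul]
  field_simp
  norm_num

end FirstOrder

/-! ### Approximate multipliers and exact penalization -/

section Multipliers

variable {E F₁ F₂ : Type*} [NormedAddCommGroup E] [InnerProductSpace ℝ E] [FiniteDimensional ℝ E]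
  [NormedAddCommGroup F₁] [InnerProductSpace ℝ F₁] [NormedAddCommGroup F₂] [InnerProductSpace ℝ F₂]

/-- Distances to nonconvex sets are not differentiable, so the nearest points `y`, `z` become
variables. Minimality in `y` and in `z` makes the residuals proximal normals, while minimality in
`x` gives stationarity. -/
theorem exists_approximate_multipliers {G₁ : E → F₁} {G₂ : E → F₂} {K₁ : Set F₁} {K₂ : Set F₂}
    {x₀ : E} {r δ M ε : ℝ} (hK₁ : IsCompact K₁) (hK₂ : IsCompact K₂) (hne : K₁.Nonempty)
    (hx₀ : G₂ x₀ ∈ K₂) (hδ : 0 < δ) (hr : 0 < r) (hM : 0 ≤ M) (hε : 0 < ε)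
    (hG₁ : ∀ x ∈ closedBall x₀ r, DifferentiableAt ℝ G₁ x)
    (hG₂ : ∀ x ∈ closedBall x₀ r, DifferentiableAt ℝ G₂ x)
    (hpos : ∀ x ∈ closedBall x₀ r, G₁ x ∉ K₁)
    (hpen : ∀ x ∈ closedBall x₀ r, infDist (G₁ x₀) K₁ ≤
      infDist (G₁ x) K₁ + M * infDist (G₂ x) K₂ + δ * ‖x - x₀‖) :
    ∃ x, ∃ y ∈ K₁, ∃ z ∈ K₂, ∃ a ∈ regularNormalCone K₁ y, ∃ b ∈ regularNormalCone K₂ z,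
      ‖x - x₀‖ ≤ ε ∧ ‖x - x₀‖ < r ∧ ‖G₁ x - y‖ ≤ infDist (G₁ x₀) K₁ + ε ∧ ‖G₂ x - z‖ ≤ ε ∧
      ‖a‖ = 1 ∧ ‖b‖ ≤ M + 1 ∧
      ∀ h, -(2 * δ * ‖h‖) ≤ inner ℝ a (fderiv ℝ G₁ x h) + inner ℝ b (fderiv ℝ G₂ x h) := by
  have hN : 0 < M + 1 := by linarith
  -- `(M + 1) * η` is the price of smoothing: the excess of the objective at the starting point over
  -- `infDist (G₁ x₀) K₁`.
  obtain ⟨η, hη, hηε, hηr⟩ : ∃ η : ℝ, 0 < η ∧ (M + 1) * η ≤ ε ∧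
      (M + 1) * η ≤ δ * (min r ε / 2) := by
    have hm : 0 < min ε (δ * (min r ε / 2)) := by positivity
    refine ⟨min ε (δ * (min r ε / 2)) / (M + 1), by positivity, ?_, ?_⟩ <;>
      rw [mul_div_cancel₀ _ hN.ne']
    exacts [min_le_left _ _, min_le_right _ _]
  -- Compared with `hpen`, the weights `M + 1` and `2 * δ` leave a surplus `‖G₂ x - z‖ + δ * ‖x -
  -- x₀‖`, which the smoothing price then bounds. The first term needs no smoothing because `hpos`
  -- keeps `G₁ x` away from `K₁`.
  let Ψ : E × F₁ × F₂ → ℝ := fun q =>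
    ‖G₁ q.1 - q.2.1‖ + (M + 1) * √(‖G₂ q.1 - q.2.2‖ ^ 2 + η ^ 2) + 2 * δ * ‖q.1 - x₀‖
  have hc₁ : ContinuousOn G₁ (closedBall x₀ r) :=
    fun x hx => (hG₁ x hx).continuousAt.continuousWithinAt
  have hc₂ : ContinuousOn G₂ (closedBall x₀ r) :=
    fun x hx => (hG₂ x hx).continuousAt.continuousWithinAt
  have hcΨ : ContinuousOn Ψ (closedBall x₀ r ×ˢ K₁ ×ˢ K₂) := by
    have h₁ : ContinuousOn (fun q : E × F₁ × F₂ => G₁ q.1) (closedBall x₀ r ×ˢ K₁ ×ˢ K₂) :=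
      hc₁.comp continuousOn_fst fun q hq => hq.1
    have h₂ : ContinuousOn (fun q : E × F₁ × F₂ => G₂ q.1) (closedBall x₀ r ×ˢ K₁ ×ˢ K₂) :=
      hc₂.comp continuousOn_fst fun q hq => hq.1
    exact ((h₁.sub (by fun_prop)).norm.add (continuousOn_const.mul
      (((h₂.sub (by fun_prop)).norm.pow 2).add continuousOn_const).sqrt)).add (by fun_prop)
  obtain ⟨y₀, hy₀, hy₀d⟩ := hK₁.exists_infDist_eq_dist hne (G₁ x₀)
  have hcomp := (isCompact_closedBall x₀ r).prod (hK₁.prod hK₂)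
  have hmem₀ : (x₀, y₀, G₂ x₀) ∈ closedBall x₀ r ×ˢ K₁ ×ˢ K₂ :=
    ⟨mem_closedBall_self hr.le, hy₀, hx₀⟩
  obtain ⟨⟨x, y, z⟩, ⟨hx, hy, hz⟩, hmin⟩ := hcomp.exists_isMinOn ⟨_, hmem₀⟩ hcΨ
  simp only at hx hy hz
  have hmin' : ∀ x' ∈ closedBall x₀ r, ∀ y' ∈ K₁, ∀ z' ∈ K₂, Ψ (x, y, z) ≤ Ψ (x', y', z') :=
    fun x' hx' y' hy' z' hz' => hmin (a := (x', y', z')) ⟨hx', hy', hz'⟩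
  have hval : Ψ (x, y, z) ≤ infDist (G₁ x₀) K₁ + (M + 1) * η := by
    refine (hmin hmem₀).trans_eq ?_
    simp [Ψ, hy₀d, dist_eq_norm, Real.sqrt_sq hη.le]
  have hs : ‖G₂ x - z‖ ≤ √(‖G₂ x - z‖ ^ 2 + η ^ 2) :=
    Real.le_sqrt_of_sq_le (by nlinarith)
  have hf₁ : infDist (G₁ x) K₁ ≤ ‖G₁ x - y‖ := by
    simpa [dist_eq_norm] using infDist_le_dist_of_mem (x := G₁ x) hy
  have hf₂ : infDist (G₂ x) K₂ ≤ ‖G₂ x - z‖ := by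
    simpa [dist_eq_norm] using infDist_le_dist_of_mem (x := G₂ x) hz
  have hkey : δ * ‖x - x₀‖ + ‖G₂ x - z‖ ≤ (M + 1) * η := by
    have h1 := hpen x hx
    have h2 : M * infDist (G₂ x) K₂ ≤ M * ‖G₂ x - z‖ := by gcongr
    have h3 : (M + 1) * ‖G₂ x - z‖ ≤ (M + 1) * √(‖G₂ x - z‖ ^ 2 + η ^ 2) := by gcongr
    simp only [Ψ] at hval
    linarith
  have hxr : ‖x - x₀‖ ≤ min r ε / 2 := by
    have h1 : δ * ‖x - x₀‖ ≤ δ * (min r ε / 2) := by linarith [norm_nonneg (G₂ x - z)]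
    exact le_of_mul_le_mul_left h1 hδ
  have hminpos : 0 < min r ε := by positivity
  have hxlt : ‖x - x₀‖ < r := by linarith [min_le_left r ε]
  set S := √(‖G₂ x - z‖ ^ 2 + η ^ 2) with hS
  have hSpos : 0 < S := Real.sqrt_pos.2 (by positivity)
  have hw : 0 < ‖G₁ x - y‖ := norm_pos_iff.2 fun h => hpos x hx (by rwa [sub_eq_zero.1 h])
  refine ⟨x, y, hy, z, hz, (‖G₁ x - y‖)⁻¹ • (G₁ x - y), ?_, ((M + 1) * S⁻¹) • (G₂ x - z), ?_,
    ?_, hxlt, ?_, ?_, ?_, ?_, ?_⟩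
  · refine smul_sub_mem_regularNormalCone (by positivity) fun y' hy' => ?_
    have := hmin' x hx y' hy' z hz
    simp only [Ψ] at this
    linarith
  · refine smul_sub_mem_regularNormalCone (by positivity) fun z' hz' => ?_
    have := hmin' x hx y hy z' hz'
    simp only [Ψ, add_le_add_iff_right, add_le_add_iff_left] at this
    rw [mul_le_mul_iff_right₀ hN, Real.sqrt_le_sqrt_iff (by positivity),
      add_le_add_iff_right] at this
    exact (pow_le_pow_iff_left₀ (norm_nonneg _) (norm_nonneg _) two_ne_zero).1 this
  · linarith [min_le_right r ε]
  · simp only [Ψ] at hval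
    have : 0 ≤ (M + 1) * S := by positivity
    have : 0 ≤ 2 * δ * ‖x - x₀‖ := by positivity
    linarith
  · linarith [mul_nonneg hδ.le (norm_nonneg (x - x₀))]
  · rw [norm_smul, norm_inv, norm_norm, inv_mul_cancel₀ hw.ne']
  · rw [norm_smul, Real.norm_eq_abs, abs_of_pos (by positivity), mul_assoc]
    refine mul_le_of_le_one_right hN.le ?_
    rw [inv_mul_le_iff₀ hSpos]
    linarith
  · intro h
    obtain ⟨f₁, hf₁, hf₁'⟩ := hasFDerivAt_sqrt_norm_sub_sq (hG₁ x hx) y (η := 0) (by positivity)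
    obtain ⟨f₂, hf₂, hf₂'⟩ := hasFDerivAt_sqrt_norm_sub_sq (hG₂ x hx) z (η := η) (by positivity)
    have hd := hf₁.add (hf₂.const_mul (M + 1))
    have hnear : ∀ᶠ x' in 𝓝 x, x' ∈ closedBall x₀ r :=
      closedBall_mem_nhds_of_mem (by rwa [mem_ball, dist_eq_norm])
    have hfo := neg_le_of_forall_le_add_norm (c := 2 * δ) hd (by
      filter_upwards [hnear] with x' hx'
      have h1 := hmin' x' hx' y hy z hz
      have h2 : ‖x' - x₀‖ ≤ ‖x' - x‖ + ‖x - x₀‖ := norm_sub_le_norm_sub_add_norm_sub _ _ _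
      have h3 : 2 * δ * ‖x' - x₀‖ ≤ 2 * δ * (‖x' - x‖ + ‖x - x₀‖) := by gcongr
      simp only [Ψ] at h1
      simp only [Pi.add_apply, ne_eq, OfNat.ofNat_ne_zero, not_false_eq_true, zero_pow, add_zero,
        Real.sqrt_sq (norm_nonneg _)]
      linarith) h
    simpa [hf₁', hf₂', Real.sqrt_sq, ← hS, mul_smul, real_inner_smul_left] using hfo

/-- An Ekeland-type minimizer over the set feasible for `G₂`, combined with exact penalization: an
arbitrary `x` is replaced by a feasible `x'` at distance at most `κ * infDist (G₂ x) K₂`, which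
changes the distance term at rate `L` and the slope term at rate `δ`; hence the weight `(L + δ) *
κ`. -/
theorem exists_penalized_minimizer {F₁ F₂ : Type*} [NormedAddCommGroup F₁] [NormedAddCommGroup F₂]
    {G₁ : E → F₁} {G₂ : E → F₂} {K₁ : Set F₁} {K₂ : Set F₂}
    {x₀ c : E} {ρ δ L κ s : ℝ} (hK₂ : IsClosed K₂) (hδ : 0 < δ) (hL : 0 ≤ L)
    (hκ : 0 ≤ κ)
    (hG₁ : ∀ x ∈ closedBall c ((1 + 2 * κ * L) * ρ), ∀ x' ∈ closedBall c ((1 + 2 * κ * L) * ρ),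
      ‖G₁ x - G₁ x'‖ ≤ L * ‖x - x'‖)
    (hG₂ : ∀ x ∈ closedBall c ((1 + 2 * κ * L) * ρ), ∀ x' ∈ closedBall c ((1 + 2 * κ * L) * ρ),
      ‖G₂ x - G₂ x'‖ ≤ L * ‖x - x'‖)
    (hbound : ∀ x ∈ closedBall c ρ, ∃ x', G₂ x' ∈ K₂ ∧ ‖x - x'‖ ≤ κ * infDist (G₂ x) K₂)
    (hx₀ : G₂ x₀ ∈ K₂) (hs : infDist (G₁ x₀) K₁ ≤ δ * s) (hx₀ρ : ‖x₀ - c‖ + s ≤ ρ)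
    (hnot : ∀ x, G₂ x ∈ K₂ → ‖x - x₀‖ ≤ s → G₁ x ∉ K₁) :
    ∃ x₁, ‖x₁ - x₀‖ ≤ s ∧ G₂ x₁ ∈ K₂ ∧ G₁ x₁ ∉ K₁ ∧ ∀ x ∈ closedBall c ρ,
      infDist (G₁ x₁) K₁ ≤
        infDist (G₁ x) K₁ + (L + δ) * κ * infDist (G₂ x) K₂ + δ * ‖x - x₁‖ := by
  -- Since `x₁` is feasible for `G₂`, a point of the `ρ`-ball has residual at most `2 * L * ρ`, so
  -- `x'` stays in the ball of radius `R`.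
  set R := (1 + 2 * κ * L) * ρ with hR
  have hs0 : 0 ≤ s := by
    by_contra! h
    linarith [mul_neg_of_pos_of_neg hδ h, infDist_nonneg (x := G₁ x₀) (s := K₁)]
  have hρ : 0 ≤ ρ := by linarith [norm_nonneg (x₀ - c)]
  have hρR : ρ ≤ R := by
    have : 0 ≤ 2 * κ * L * ρ := by positivity
    rw [hR]; linarith
  have hcont₁ : ContinuousOn G₁ (closedBall c R) :=
    (LipschitzOnWith.of_dist_le_mul (K := ⟨L, hL⟩) fun x hx y hy => by
      rw [dist_eq_norm, dist_eq_norm]; exact hG₁ x hx y hy).continuousOn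
  have hcont₂ : ContinuousOn G₂ (closedBall c R) :=
    (LipschitzOnWith.of_dist_le_mul (K := ⟨L, hL⟩) fun x hx y hy => by
      rw [dist_eq_norm, dist_eq_norm]; exact hG₂ x hx y hy).continuousOn
  have hclosed : IsClosed (closedBall c R ∩ G₂ ⁻¹' K₂) :=
    hcont₂.preimage_isClosed_of_isClosed isClosed_closedBall hK₂
  have hcomp : IsCompact (closedBall c R ∩ G₂ ⁻¹' K₂) :=
    (isCompact_closedBall c R).of_isClosed_subset hclosed Set.inter_subset_left
  have hx₀R : x₀ ∈ closedBall c R := by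
    rw [mem_closedBall, dist_eq_norm]; linarith
  obtain ⟨x₁, ⟨hx₁R, hx₁⟩, hmin⟩ := hcomp.exists_isMinOn ⟨x₀, hx₀R, hx₀⟩
    (f := fun x => infDist (G₁ x) K₁ + δ * ‖x - x₀‖)
    (((continuous_infDist_pt K₁).comp_continuousOn (hcont₁.mono Set.inter_subset_left)).add
      (by fun_prop))
  have hdist : ‖x₁ - x₀‖ ≤ s := by
    have h1 : infDist (G₁ x₁) K₁ + δ * ‖x₁ - x₀‖ ≤ infDist (G₁ x₀) K₁ + δ * ‖x₀ - x₀‖ :=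
      hmin ⟨hx₀R, hx₀⟩
    rw [sub_self, norm_zero, mul_zero, add_zero] at h1
    have h2 : δ * ‖x₁ - x₀‖ ≤ δ * s := by
      linarith [infDist_nonneg (x := G₁ x₁) (s := K₁)]
    exact le_of_mul_le_mul_left h2 hδ
  refine ⟨x₁, hdist, hx₁, hnot x₁ hx₁ hdist, fun x hx => ?_⟩
  obtain ⟨x', hx', hxx'⟩ := hbound x hx
  have hxR : x ∈ closedBall c R := closedBall_subset_closedBall hρR hx
  have hx₁ρ : ‖x₁ - c‖ ≤ ρ := by
    linarith [norm_sub_le_norm_sub_add_norm_sub x₁ x₀ c]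
  rw [mem_closedBall, dist_eq_norm] at hx
  have hd₂ : infDist (G₂ x) K₂ ≤ L * (2 * ρ) := by
    have h1 : infDist (G₂ x) K₂ ≤ ‖G₂ x - G₂ x₁‖ := by
      rw [← dist_eq_norm]; exact infDist_le_dist_of_mem hx₁
    have h2 : ‖x - x₁‖ ≤ 2 * ρ := by
      linarith [norm_sub_le_norm_sub_add_norm_sub x c x₁, norm_sub_rev c x₁]
    calc _ ≤ _ := h1
      _ ≤ L * ‖x - x₁‖ := hG₂ x hxR x₁ hx₁R
      _ ≤ _ := by gcongr
  have hx'R : x' ∈ closedBall c R := by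
    rw [mem_closedBall, dist_eq_norm]
    have h1 : κ * infDist (G₂ x) K₂ ≤ κ * (L * (2 * ρ)) := by gcongr
    have h2 := norm_sub_le_norm_sub_add_norm_sub x' x c
    rw [norm_sub_rev x' x] at h2
    rw [hR]
    linarith
  have h1 : infDist (G₁ x₁) K₁ + δ * ‖x₁ - x₀‖ ≤ infDist (G₁ x') K₁ + δ * ‖x' - x₀‖ :=
    hmin ⟨hx'R, hx'⟩
  have h2 : infDist (G₁ x') K₁ ≤ infDist (G₁ x) K₁ + L * ‖x - x'‖ := by
    have := infDist_le_infDist_add_dist (s := K₁) (x := G₁ x') (y := G₁ x)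
    rw [dist_comm, dist_eq_norm] at this
    linarith [hG₁ x hxR x' hx'R]
  have h3 : ‖x' - x₀‖ ≤ ‖x - x'‖ + ‖x - x₁‖ + ‖x₁ - x₀‖ := by
    linarith [norm_sub_le_norm_sub_add_norm_sub x' x x₀, norm_sub_rev x' x,
      norm_sub_le_norm_sub_add_norm_sub x x₁ x₀]
  have h4 : δ * ‖x' - x₀‖ ≤ δ * (‖x - x'‖ + ‖x - x₁‖ + ‖x₁ - x₀‖) := by gcongr
  have h5 : (L + δ) * ‖x - x'‖ ≤ (L + δ) * (κ * infDist (G₂ x) K₂) := by gcongr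
  linarith

end Multipliers

/-! ### Distances in products and uniform smoothness near the reference point -/

section Preliminaries

theorem LocallyClosedAround.exists_forall_le {F : Type*} [NormedAddCommGroup F] {Ω : Set F} {z : F}
    (h : LocallyClosedAround Ω z) :
    ∃ R : ℝ, 0 < R ∧ ∀ r ≤ R, IsClosed (Ω ∩ closedBall z r) := by
  obtain ⟨R, hR, hcl⟩ := h
  refine ⟨R, hR, fun r hr => ?_⟩
  have : Ω ∩ closedBall z r = (Ω ∩ closedBall z R) ∩ closedBall z r := by
    rw [Set.inter_assoc, Set.inter_eq_right.2 (closedBall_subset_closedBall hr)]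
  rw [this]
  exact hcl.inter isClosed_closedBall

/-- Enlarging the modulus by one makes the bound strict when the residual is positive, so an actual
point of `S` realizes it. -/
theorem exists_norm_sub_le_of_infEDist_le {E F : Type*} [NormedAddCommGroup E]
    [NormedAddCommGroup F] {S : Set E} {K C : Set F} {x : E} {q : F} {κ : ℝ≥0} (hKC : K ⊆ C)
    (hne : K.Nonempty) (hpos : 0 < infDist q K) (h : infEDist x S ≤ κ * infEDist q C) :
    ∃ x' ∈ S, ‖x - x'‖ ≤ (κ + 1) * infDist q K := by
  have h1 : infEDist x S < ENNReal.ofReal ((κ + 1) * infDist q K) := by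
    refine (h.trans (mul_le_mul_right (infEDist_anti hKC) _)).trans_lt ?_
    rw [← ENNReal.ofReal_toReal (infEDist_ne_top hne), ← ENNReal.ofReal_coe_nnreal,
      ← ENNReal.ofReal_mul κ.coe_nonneg]
    exact (ENNReal.ofReal_lt_ofReal_iff (by positivity)).2
      (by change _ * infDist q K < _; linarith)
  obtain ⟨x', hx', hlt⟩ := infEDist_lt_iff.1 h1
  refine ⟨x', hx', ?_⟩
  rw [edist_dist, dist_eq_norm] at hlt
  exact ((ENNReal.ofReal_lt_ofReal_iff (by positivity)).1 hlt).le

variable {F₁ F₂ : Type*} [NormedAddCommGroup F₁] [NormedAddCommGroup F₂]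

theorem infDist_fst_le_infDist_splitSet {C₁ : Set F₁} {C₂ : Set F₂} {c q : WithLp 2 (F₁ × F₂)}
    (hc : c ∈ splitSet C₁ C₂) : infDist q.fst C₁ ≤ infDist q (splitSet C₁ C₂) := by
  refine le_of_forall_gt fun a ha => ?_
  obtain ⟨y, hy, hlt⟩ := (infDist_lt_iff ⟨c, hc⟩).1 ha
  exact ((infDist_le_dist_of_mem hy.1).trans (WithLp.dist_fst_le q y)).trans_lt hlt

theorem infDist_snd_le_infDist_splitSet {C₁ : Set F₁} {C₂ : Set F₂} {c q : WithLp 2 (F₁ × F₂)}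
    (hc : c ∈ splitSet C₁ C₂) : infDist q.snd C₂ ≤ infDist q (splitSet C₁ C₂) := by
  refine le_of_forall_gt fun a ha => ?_
  obtain ⟨y, hy, hlt⟩ := (infDist_lt_iff ⟨c, hc⟩).1 ha
  exact ((infDist_le_dist_of_mem hy.2).trans (WithLp.dist_snd_le q y)).trans_lt hlt

theorem PartiallySmoothAt.exists_closedBall {P E F : Type*} [TopologicalSpace P]
    [NormedAddCommGroup E] [NormedSpace ℝ E] [NormedAddCommGroup F] [NormedSpace ℝ F]
    {g : P → E → F} {pbar : P} {xbar : E} (hg : PartiallySmoothAt g pbar xbar) {δ : ℝ}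
    (hδ : 0 < δ) : ∃ R > 0, ∃ V ∈ 𝓝 pbar, ∀ p ∈ V, ∀ x ∈ closedBall xbar R,
      DifferentiableAt ℝ (g p) x ∧ ‖g p x - g pbar xbar‖ < δ ∧
        ‖fderiv ℝ (g p) x - fderiv ℝ (g pbar) xbar‖ < δ := by
  obtain ⟨⟨U, hU, hxU, V₀, hV₀, hd⟩, hc, hc'⟩ := hg
  have h1 := hc.eventually (ball_mem_nhds _ hδ)
  have h2 := hc'.eventually (ball_mem_nhds _ hδ)
  rw [nhds_prod_eq] at h1 h2
  obtain ⟨V, hV, W, hW, hVW⟩ := mem_prod_iff.1 (h1.and h2)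
  obtain ⟨R, hR, hRW⟩ := nhds_basis_closedBall.mem_iff.1 (inter_mem hW (hU.mem_nhds hxU))
  refine ⟨R, hR, V ∩ V₀, inter_mem hV hV₀, fun p hp x hx => ⟨?_, ?_, ?_⟩⟩
  · exact ((hd p hp.2).differentiableOn one_ne_zero).differentiableAt (hU.mem_nhds (hRW hx).2)
  · have := (hVW (Set.mk_mem_prod hp.1 (hRW hx).1)).1
    rwa [← dist_eq_norm]
  · have := (hVW (Set.mk_mem_prod hp.1 (hRW hx).1)).2
    rwa [← dist_eq_norm]

variable {E : Type*} [NormedAddCommGroup E] [NormedSpace ℝ E] [NormedSpace ℝ F₁] [NormedSpace ℝ F₂]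
  {P : Type*} {g₁ : P → E → F₁} {g₂ : P → E → F₂} {p : P} {x : E}

theorem hasFDerivAt_of_splitMap_fst (h : DifferentiableAt ℝ (splitMap g₁ g₂ p) x) :
    HasFDerivAt (g₁ p) ((WithLp.fstL 2 ℝ F₁ F₂).comp (fderiv ℝ (splitMap g₁ g₂ p) x)) x :=
  (WithLp.fstL 2 ℝ F₁ F₂).hasFDerivAt.comp x h.hasFDerivAt

theorem hasFDerivAt_of_splitMap_snd (h : DifferentiableAt ℝ (splitMap g₁ g₂ p) x) :
    HasFDerivAt (g₂ p) ((WithLp.sndL 2 ℝ F₁ F₂).comp (fderiv ℝ (splitMap g₁ g₂ p) x)) x :=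
  (WithLp.sndL 2 ℝ F₁ F₂).hasFDerivAt.comp x h.hasFDerivAt

end Preliminaries

/-- A point `x₁` close to `xbar` that minimizes the distance of `g₁ p` to `C₁`, up to the small
slope `δ` and a penalty on the second constraint, together with a nearby point `x` satisfying
first-order conditions with multipliers `a`, `b`. -/
structure ApproxCriticalPoint {P E F₁ F₂ : Type*}
    [NormedAddCommGroup E] [InnerProductSpace ℝ E]
    [NormedAddCommGroup F₁] [InnerProductSpace ℝ F₁]
    [NormedAddCommGroup F₂] [InnerProductSpace ℝ F₂]
    (g₁ : P → E → F₁) (g₂ : P → E → F₂) (C₁ : Set F₁) (C₂ : Set F₂) (ζ : P → ℝ)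
    (pbar : P) (xbar : E) (M δ : ℝ) where
  p : P
  x₁ : E
  x : E
  ρ : ℝ
  y : F₁
  z : F₂
  a : F₁
  b : F₂
  ρ_pos : 0 < ρ
  ρ_le : ρ ≤ 1
  scale_pos : 0 < ‖x₁ - xbar‖ + ‖splitMap g₁ g₂ p xbar - splitMap g₁ g₂ pbar xbar‖
  scale_lt : ‖x₁ - xbar‖ + ‖splitMap g₁ g₂ p xbar - splitMap g₁ g₂ pbar xbar‖ < δ * ρ
  differentiableAt : DifferentiableAt ℝ (splitMap g₁ g₂ p) xbar
  fderiv_lt : ‖fderiv ℝ (splitMap g₁ g₂ p) xbar - fderiv ℝ (splitMap g₁ g₂ pbar) xbar‖ < δ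
  zeta_lt : |ζ p - ζ pbar| < δ
  linearization : ∀ u ∈ closedBall xbar ρ, ∀ u' ∈ closedBall xbar ρ,
    ‖splitMap g₁ g₂ p u - splitMap g₁ g₂ p u' - fderiv ℝ (splitMap g₁ g₂ pbar) xbar (u - u')‖ ≤
      δ * ‖u - u'‖
  penalized : ∀ u ∈ closedBall xbar ρ,
    infDist (g₁ p x₁) C₁ ≤ infDist (g₁ p u) C₁ + M * infDist (g₂ p u) C₂ + δ * ‖u - x₁‖
  norm_sub_le : ‖x - x₁‖ ≤
    δ * (‖x₁ - xbar‖ + ‖splitMap g₁ g₂ p xbar - splitMap g₁ g₂ pbar xbar‖)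
  x_mem : x ∈ closedBall xbar ρ
  y_mem : y ∈ C₁
  z_mem : z ∈ C₂
  norm_sub_y_le : ‖g₁ p x - y‖ ≤ infDist (g₁ p x₁) C₁ +
    δ * (‖x₁ - xbar‖ + ‖splitMap g₁ g₂ p xbar - splitMap g₁ g₂ pbar xbar‖)
  norm_sub_z_le : ‖g₂ p x - z‖ ≤
    δ * (‖x₁ - xbar‖ + ‖splitMap g₁ g₂ p xbar - splitMap g₁ g₂ pbar xbar‖)
  a_mem : a ∈ regularNormalCone C₁ y
  b_mem : b ∈ regularNormalCone C₂ z
  norm_a : ‖a‖ = 1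
  norm_b_le : ‖b‖ ≤ M
  stationary : ∀ h, -(M * δ * ‖h‖) ≤
    inner ℝ a (fderiv ℝ (splitMap g₁ g₂ pbar) xbar h).fst +
      inner ℝ b (fderiv ℝ (splitMap g₁ g₂ pbar) xbar h).snd

theorem exists_lt_norm_sub_of_not_robinsonStable {P E F : Type*} [TopologicalSpace P]
    [NormedAddCommGroup E] [NormedAddCommGroup F] {pbar : P} {xbar : E}
    {g : P → E → F} {C : Set F} (hnot : ¬ RobinsonStable g C pbar xbar) (hC : C.Nonempty)
    {B r : ℝ} (hB : 0 ≤ B) (hr : 0 < r) {V : Set P} (hV : V ∈ 𝓝 pbar) :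
    ∃ p ∈ V, ∃ w ∈ closedBall xbar r, ∀ x, g p x ∈ C → B * infDist (g p w) C < ‖w - x‖ := by
  by_contra! hcon
  refine hnot ⟨B.toNNReal, closedBall xbar r, closedBall_mem_nhds _ hr, V, hV, fun p hp w hw => ?_⟩
  obtain ⟨x, hx, hle⟩ := hcon p hp w hw
  refine (infEDist_le_edist_of_mem (show x ∈ solutionMap g C p from hx)).trans ?_
  rw [edist_dist, dist_eq_norm, ← ENNReal.ofReal_toReal (infEDist_ne_top hC),
    ← ENNReal.ofReal_coe_nnreal, Real.coe_toNNReal B hB, ← ENNReal.ofReal_mul hB]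
  exact ENNReal.ofReal_le_ofReal hle

/-! ### From failure of stability to approximate critical points -/

section ExistenceOfCriticalPoints

variable {P E F₁ F₂ : Type*} [TopologicalSpace P]
  [NormedAddCommGroup E] [InnerProductSpace ℝ E] [FiniteDimensional ℝ E]
  [NormedAddCommGroup F₁] [InnerProductSpace ℝ F₁] [FiniteDimensional ℝ F₁]
  [NormedAddCommGroup F₂] [InnerProductSpace ℝ F₂] [FiniteDimensional ℝ F₂]
  {g₁ : P → E → F₁} {g₂ : P → E → F₂} {C₁ : Set F₁} {C₂ : Set F₂} {ζ : P → ℝ}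
  {pbar : P} {xbar : E}

set_option maxHeartbeats 1600000 in
theorem exists_approxCriticalPoint
    (hfeas : xbar ∈ solutionMap (splitMap g₁ g₂) (splitSet C₁ C₂) pbar)
    (hC₁ : LocallyClosedAround C₁ (g₁ pbar xbar)) (hC₂ : LocallyClosedAround C₂ (g₂ pbar xbar))
    (hg : PartiallySmoothAt (splitMap g₁ g₂) pbar xbar) (hζ : ContinuousAt ζ pbar)
    (hRS : RobinsonStable g₂ C₂ pbar xbar)
    (hnot : ¬ RobinsonStable (splitMap g₁ g₂) (splitSet C₁ C₂) pbar xbar) :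
    ∃ M : ℝ, 0 ≤ M ∧ ∀ δ : ℝ, 0 < δ → δ ≤ 1 →
      Nonempty (ApproxCriticalPoint g₁ g₂ C₁ C₂ ζ pbar xbar M δ) := by
  obtain ⟨r₁, hr₁, hcl₁⟩ := hC₁.exists_forall_le
  obtain ⟨r₂, hr₂, hcl₂⟩ := hC₂.exists_forall_le
  obtain ⟨κ₀, U₂, hU₂, V₂, hV₂, hstab⟩ := hRS
  obtain ⟨r₃, hr₃, hr₃U⟩ := nhds_basis_closedBall.mem_iff.1 hU₂
  obtain ⟨r, hr, hrr₁, hrr₂⟩ : ∃ r : ℝ, 0 < r ∧ r ≤ r₁ ∧ r ≤ r₂ :=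
    ⟨min r₁ r₂, lt_min hr₁ hr₂, min_le_left _ _, min_le_right _ _⟩
  have hc₁ : g₁ pbar xbar ∈ C₁ := hfeas.1
  have hc₂ : g₂ pbar xbar ∈ C₂ := hfeas.2
  set c₁ := g₁ pbar xbar with hc₁def
  set c₂ := g₂ pbar xbar with hc₂def
  set G := splitMap g₁ g₂ with hG
  have hC : G pbar xbar ∈ splitSet C₁ C₂ := hfeas
  set A := fderiv ℝ (G pbar) xbar with hA
  set K₁ := C₁ ∩ closedBall c₁ r with hK₁def
  set K₂ := C₂ ∩ closedBall c₂ r with hK₂def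
  have hK₁ : IsCompact K₁ :=
    (isCompact_closedBall c₁ r).of_isClosed_subset (hcl₁ r hrr₁) Set.inter_subset_right
  have hK₂ : IsCompact K₂ :=
    (isCompact_closedBall c₂ r).of_isClosed_subset (hcl₂ r hrr₂) Set.inter_subset_right
  have hcK₁ : c₁ ∈ K₁ := ⟨hc₁, mem_closedBall_self hr.le⟩
  have hcK₂ : c₂ ∈ K₂ := ⟨hc₂, mem_closedBall_self hr.le⟩
  obtain ⟨L, hL⟩ : ∃ L, L = ‖A‖ + 1 := ⟨_, rfl⟩
  have hL0 : 0 ≤ L := by rw [hL]; positivity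
  obtain ⟨κ, hκ⟩ : ∃ κ : ℝ, κ = κ₀ + 1 := ⟨_, rfl⟩
  have hκ0 : 0 ≤ κ := by rw [hκ]; positivity
  -- The stationarity error sets this constant: slope `2δ`, plus `δ` and `((L + 1) * κ + 1) * δ` for
  -- replacing the derivative at `x` by `A` against `a` and `b`.
  refine ⟨(L + 1) * κ + 4, by positivity, fun δ hδ hδ1 => ?_⟩
  obtain ⟨R, hR, V, hV, hsm⟩ := hg.exists_closedBall (δ := min δ (r / 4)) (by positivity)
  obtain ⟨ρ, hρ, hρ1, hρr, hρ₃, hρR⟩ : ∃ ρ : ℝ, 0 < ρ ∧ ρ ≤ 1 ∧ ρ ≤ r / 4 ∧ ρ ≤ r₃ ∧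
      (2 + 2 * κ * L) * ρ ≤ R := by
    have hm : 0 < min (min 1 (r / 4)) (min r₃ R) := by positivity
    have hden : 1 ≤ 2 + 2 * κ * L := by
      have : 0 ≤ 2 * κ * L := by positivity
      linarith
    have hle := div_le_self hm.le hden
    refine ⟨min (min 1 (r / 4)) (min r₃ R) / (2 + 2 * κ * L), by positivity,
      hle.trans ((min_le_left _ _).trans (min_le_left _ _)),
      hle.trans ((min_le_left _ _).trans (min_le_right _ _)),
      hle.trans ((min_le_right _ _).trans (min_le_left _ _)), ?_⟩
    rw [mul_div_cancel₀ _ (by positivity)]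
    exact (min_le_right _ _).trans (min_le_right _ _)
  have hκL : 0 ≤ 2 * κ * L * ρ := by positivity
  have hρR' : (1 + 2 * κ * L) * ρ ≤ R := by linarith
  have hρ_le_R : ρ ≤ R := by linarith
  -- Below, `w`, `x₀`, `x₁` lie within `β`, `2β`, `3β` of `xbar`, and the parameter increment is
  -- below `τ ≤ β`, so the scale is at most `4β < δ * ρ`.
  obtain ⟨β, hβ⟩ : ∃ β : ℝ, β = δ * ρ / 8 := ⟨_, rfl⟩
  have hβ0 : 0 < β := by rw [hβ]; positivity
  have hβρ : 8 * β ≤ ρ := by rw [hβ]; nlinarith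
  obtain ⟨τ, hτ, hτβ, hκτ, hcτ⟩ : ∃ τ : ℝ, 0 < τ ∧ τ ≤ β ∧ κ * τ ≤ β ∧
      (1 + L * κ) * τ ≤ δ * β := by
    have hden : 0 < 1 + κ + L * κ := by positivity
    obtain ⟨τ, hτ, hτ'⟩ : ∃ τ : ℝ, 0 < τ ∧ (1 + κ + L * κ) * τ = δ * β :=
      ⟨δ * β / (1 + κ + L * κ), by positivity, mul_div_cancel₀ _ hden.ne'⟩
    have h1 : 0 ≤ κ * τ := by positivity
    have h2 : 0 ≤ L * κ * τ := by positivity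
    have h3 : δ * β ≤ β := mul_le_of_le_one_left hβ0.le hδ1
    exact ⟨τ, hτ, by linarith, by linarith, by linarith⟩
  obtain ⟨R', hR', V', hV', hsm'⟩ := hg.exists_closedBall hτ
  have hVζ : {p | |ζ p - ζ pbar| < δ} ∈ 𝓝 pbar := by
    exact hζ.eventually (ball_mem_nhds _ hδ)
  -- The modulus `B` adds the cost `κ` of reaching `x₀` to the ratio `(1 + L * κ) / δ` bounding the
  -- search radius `s`, so no feasible point lies within `s` of `x₀`.
  obtain ⟨p, ⟨⟨⟨hpV, hpV₂⟩, hpV'⟩, hpζ⟩, w, hw, hfar⟩ :=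
    exists_lt_norm_sub_of_not_robinsonStable (B := κ + (1 + L * κ) / δ) (r := min R' β) hnot
      ⟨_, hC⟩ (by positivity) (by positivity)
      (inter_mem (inter_mem (inter_mem hV hV₂) hV') hVζ)
  have hwR' : w ∈ closedBall xbar R' := closedBall_subset_closedBall (min_le_left _ _) hw
  have hwβ : ‖w - xbar‖ ≤ β := by
    rw [← dist_eq_norm]; exact (mem_closedBall.1 hw).trans (min_le_right _ _)
  have hdiff : ∀ x ∈ closedBall xbar R, DifferentiableAt ℝ (G p) x := fun x hx => (hsm p hpV x hx).1
  have hlin : ∀ x ∈ closedBall xbar R, ∀ x' ∈ closedBall xbar R,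
      ‖G p x - G p x' - A (x - x')‖ ≤ δ * ‖x - x'‖ := fun x hx x' hx' =>
    (convex_closedBall xbar R).norm_image_sub_le_of_norm_fderiv_le' hdiff
      (fun y hy => (hsm p hpV y hy).2.2.le.trans (min_le_left _ _)) hx' hx
  have hlip : ∀ x ∈ closedBall xbar R, ∀ x' ∈ closedBall xbar R,
      ‖G p x - G p x'‖ ≤ L * ‖x - x'‖ := fun x hx x' hx' => by
    have h1 := hlin x hx x' hx'
    have h2 := A.le_opNorm (x - x')
    have h3 := norm_le_norm_sub_add (G p x - G p x') (A (x - x'))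
    have h4 : δ * ‖x - x'‖ ≤ 1 * ‖x - x'‖ := by gcongr
    rw [hL]; linarith
  have hlip₁ : ∀ x ∈ closedBall xbar R, ∀ x' ∈ closedBall xbar R,
      ‖g₁ p x - g₁ p x'‖ ≤ L * ‖x - x'‖ := fun x hx x' hx' =>
    (WithLp.norm_fst_le _ (G p x - G p x')).trans (hlip x hx x' hx')
  have hlip₂ : ∀ x ∈ closedBall xbar R, ∀ x' ∈ closedBall xbar R,
      ‖g₂ p x - g₂ p x'‖ ≤ L * ‖x - x'‖ := fun x hx x' hx' =>
    (WithLp.norm_snd_le _ (G p x - G p x')).trans (hlip x hx x' hx')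
  have hnear₁ : ∀ x ∈ closedBall xbar R, ‖g₁ p x - c₁‖ < r / 4 := fun x hx =>
    (WithLp.norm_fst_le _ (G p x - G pbar xbar)).trans_lt
      ((hsm p hpV x hx).2.1.trans_le (min_le_right _ _))
  have hnear₂ : ∀ x ∈ closedBall xbar R, ‖g₂ p x - c₂‖ < r / 4 := fun x hx =>
    (WithLp.norm_snd_le _ (G p x - G pbar xbar)).trans_lt
      ((hsm p hpV x hx).2.1.trans_le (min_le_right _ _))
  have hdK₁ : ∀ x ∈ closedBall xbar R, infDist (g₁ p x) K₁ ≤ infDist (g₁ p x) C₁ := fun x hx =>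
    infDist_inter_closedBall_le hc₁ (by rw [dist_eq_norm]; linarith [hnear₁ x hx])
  have hdK₂ : ∀ x ∈ closedBall xbar R, infDist (g₂ p x) K₂ ≤ infDist (g₂ p x) C₂ := fun x hx =>
    infDist_inter_closedBall_le hc₂ (by rw [dist_eq_norm]; linarith [hnear₂ x hx])
  have hxbarR : xbar ∈ closedBall xbar R := mem_closedBall_self hR.le
  have hsubR : closedBall xbar ρ ⊆ closedBall xbar R := closedBall_subset_closedBall hρ_le_R
  have hGτ : ‖G p xbar - G pbar xbar‖ < τ := (hsm' p hpV' xbar (mem_closedBall_self hR'.le)).2.1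
  have hbound : ∀ x ∈ closedBall xbar ρ,
      ∃ x', g₂ p x' ∈ K₂ ∧ ‖x - x'‖ ≤ κ * infDist (g₂ p x) K₂ := by
    intro x hx
    by_cases h0 : infDist (g₂ p x) K₂ = 0
    · refine ⟨x, (hK₂.isClosed.mem_iff_infDist_zero ⟨c₂, hcK₂⟩).2 h0, by simp [h0]⟩
    · obtain ⟨x', hx', hle⟩ := exists_norm_sub_le_of_infEDist_le (K := K₂) Set.inter_subset_left
        ⟨c₂, hcK₂⟩ (lt_of_le_of_ne infDist_nonneg (Ne.symm h0))
        (hstab p hpV₂ x (hr₃U (closedBall_subset_closedBall hρ₃ hx)))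
      rw [← hκ] at hle
      refine ⟨x', ⟨hx', ?_⟩, hle⟩
      have hxρ : ‖x - xbar‖ ≤ ρ := by rw [← dist_eq_norm]; exact hx
      have h1 : infDist (g₂ p x) K₂ ≤ L * ρ + τ := by
        calc infDist (g₂ p x) K₂ ≤ ‖g₂ p x - c₂‖ := by
              rw [← dist_eq_norm]; exact infDist_le_dist_of_mem hcK₂
          _ ≤ ‖g₂ p x - g₂ p xbar‖ + ‖g₂ p xbar - c₂‖ := norm_sub_le_norm_sub_add_norm_sub _ _ _
          _ ≤ L * ‖x - xbar‖ + τ := add_le_add (hlip₂ x (hsubR hx) xbar hxbarR)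
              ((WithLp.norm_snd_le _ (G p xbar - G pbar xbar)).trans hGτ.le)
          _ ≤ L * ρ + τ := by gcongr
      have h2 : κ * infDist (g₂ p x) K₂ ≤ κ * (L * ρ + τ) := by gcongr
      have hκLρ : 0 ≤ κ * L * ρ := by positivity
      have hx'R : x' ∈ closedBall xbar R := by
        rw [mem_closedBall, dist_eq_norm]
        linarith [norm_sub_le_norm_sub_add_norm_sub x' x xbar, norm_sub_rev x' x]
      rw [mem_closedBall, dist_eq_norm]
      linarith [hnear₂ x' hx'R]
  -- the starting point of the minimization
  set d := infDist (G p w) (splitSet C₁ C₂) with hd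
  have hdτ : d ≤ τ := by
    refine (infDist_le_dist_of_mem hC).trans ?_
    rw [dist_eq_norm]
    exact (hsm' p hpV' w hwR').2.1.le
  have hd0 : 0 ≤ d := infDist_nonneg
  have hwρ : w ∈ closedBall xbar ρ := by
    rw [mem_closedBall, dist_eq_norm]; linarith
  obtain ⟨x₀, hx₀, hwx₀⟩ := hbound w hwρ
  have hwx₀' : ‖w - x₀‖ ≤ κ * d := by
    refine hwx₀.trans ?_
    gcongr
    exact (hdK₂ w (hsubR hwρ)).trans (infDist_snd_le_infDist_splitSet (q := G p w) hC)
  have hκd : κ * d ≤ β := le_trans (by gcongr) hκτ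
  have hx₀R : x₀ ∈ closedBall xbar R := by
    rw [mem_closedBall, dist_eq_norm]
    linarith [norm_sub_le_norm_sub_add_norm_sub x₀ w xbar, norm_sub_rev x₀ w]
  have hf₀ : infDist (g₁ p x₀) K₁ ≤ (1 + L * κ) * d := by
    have h1 := infDist_le_infDist_add_dist (s := K₁) (x := g₁ p x₀) (y := g₁ p w)
    have h2 : infDist (g₁ p w) K₁ ≤ d :=
      (hdK₁ w (hsubR hwρ)).trans (infDist_fst_le_infDist_splitSet (q := G p w) hC)
    have h3 := hlip₁ w (hsubR hwρ) x₀ hx₀R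
    have h4 : L * ‖w - x₀‖ ≤ L * (κ * d) := by gcongr
    rw [dist_comm, dist_eq_norm] at h1
    linarith
  obtain ⟨s, hs⟩ : ∃ s, s = infDist (g₁ p x₀) K₁ / δ := ⟨_, rfl⟩
  have hsd : s ≤ (1 + L * κ) / δ * d := by
    rw [hs, div_mul_eq_mul_div]; gcongr
  have hsβ : s ≤ β := by
    rw [hs, div_le_iff₀ hδ, mul_comm β]
    exact hf₀.trans (le_trans (by gcongr) hcτ)
  have hx₀c : ‖x₀ - xbar‖ ≤ 2 * β := by
    linarith [norm_sub_le_norm_sub_add_norm_sub x₀ w xbar, norm_sub_rev x₀ w]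
  obtain ⟨x₁, hx₁x₀, hx₁K₂, hx₁K₁, hpen⟩ := exists_penalized_minimizer (K₁ := K₁) (G₁ := g₁ p)
    (s := s) (c := xbar)
    (ρ := ρ) (L := L) hK₂.isClosed hδ hL0 hκ0
    (fun x hx x' hx' => hlip₁ x (closedBall_subset_closedBall hρR' hx) x'
      (closedBall_subset_closedBall hρR' hx'))
    (fun x hx x' hx' => hlip₂ x (closedBall_subset_closedBall hρR' hx) x'
      (closedBall_subset_closedBall hρR' hx'))
    hbound hx₀ (by rw [hs, mul_div_cancel₀ _ hδ.ne']) (by linarith) (fun x hx hxs hxK => by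
      have h1 := hfar x ⟨hxK.1, hx.1⟩
      have h2 := norm_sub_le_norm_sub_add_norm_sub w x₀ x
      rw [norm_sub_rev x₀ x] at h2
      rw [add_mul] at h1
      linarith)
  have hx₁c : ‖x₁ - xbar‖ ≤ 3 * β := by
    linarith [norm_sub_le_norm_sub_add_norm_sub x₁ x₀ xbar]
  have hx₁R : x₁ ∈ closedBall xbar R := by
    rw [mem_closedBall, dist_eq_norm]; linarith
  obtain ⟨t, ht⟩ : ∃ t, t = ‖x₁ - xbar‖ + ‖G p xbar - G pbar xbar‖ := ⟨_, rfl⟩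
  -- If `t` vanished, `g₁ p x₁` would equal `c₁ ∈ K₁`, but `x₁` is infeasible.
  have ht0 : 0 < t := by
    refine lt_of_le_of_ne (by rw [ht]; positivity) fun h0 => hx₁K₁ ?_
    have h1 : ‖x₁ - xbar‖ = 0 := by
      linarith [norm_nonneg (x₁ - xbar), norm_nonneg (G p xbar - G pbar xbar)]
    have h2 : ‖G p xbar - G pbar xbar‖ = 0 := by
      linarith [norm_nonneg (x₁ - xbar), norm_nonneg (G p xbar - G pbar xbar)]
    rw [sub_eq_zero.1 (norm_eq_zero.1 h1)]
    have h3 := congrArg WithLp.fst (sub_eq_zero.1 (norm_eq_zero.1 h2))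
    change g₁ p xbar = g₁ pbar xbar at h3
    rwa [h3]
  have htβ : t ≤ 4 * β := by linarith
  have htρ : t < δ * ρ := by linarith
  have hδt : δ * t ≤ t := mul_le_of_le_one_left ht0.le hδ1
  have hpen' : ∀ x ∈ closedBall xbar ρ, infDist (g₁ p x₁) K₁ ≤
      infDist (g₁ p x) K₁ + (L + 1) * κ * infDist (g₂ p x) K₂ + δ * ‖x - x₁‖ := fun x hx => by
    refine (hpen x hx).trans ?_
    gcongr
    exact infDist_nonneg
  -- first-order conditions at a nearby point
  obtain ⟨r', hr', hr'ρ, hr'K⟩ : ∃ r' : ℝ, 0 < r' ∧ r' ≤ ρ / 2 ∧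
      ∀ x ∈ closedBall x₁ r', g₁ p x ∉ K₁ := by
    have hcont : ContinuousAt (g₁ p) x₁ :=
      (hasFDerivAt_of_splitMap_fst (hdiff x₁ hx₁R)).continuousAt
    obtain ⟨r', hr', hsub⟩ := nhds_basis_closedBall.mem_iff.1
      (hcont.preimage_mem_nhds (hK₁.isClosed.isOpen_compl.mem_nhds hx₁K₁))
    exact ⟨min r' (ρ / 2), by positivity, min_le_right _ _, fun x hx =>
      hsub (closedBall_subset_closedBall (min_le_left _ _) hx)⟩
  have hballρ : closedBall x₁ r' ⊆ closedBall xbar ρ := closedBall_subset_closedBall' (by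
    rw [dist_eq_norm]; linarith)
  -- The tolerance `ε = δ * t` makes all perturbations negligible at the scale `t`.
  obtain ⟨x, y, hy, z, hz, a, ha, b, hb, hxx₁, hxr', hxy, hxz, hna, hnb, hstat⟩ :=
    exists_approximate_multipliers hK₁ hK₂ ⟨c₁, hcK₁⟩ hx₁K₂ hδ hr'
      (M := (L + 1) * κ) (ε := δ * t) (by positivity) (by positivity)
      (fun x hx => (hasFDerivAt_of_splitMap_fst (hdiff x (hsubR (hballρ hx)))).differentiableAt)
      (fun x hx => (hasFDerivAt_of_splitMap_snd (hdiff x (hsubR (hballρ hx)))).differentiableAt)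
      hr'K (fun x hx => hpen' x (hballρ hx))
  have hxρ : x ∈ closedBall xbar ρ := hballρ (by
    rw [mem_closedBall, dist_eq_norm]; exact hxr'.le)
  have hxR := hsubR hxρ
  have hxdiff := hdiff x hxR
  have hy_ball : y ∈ ball c₁ r := by
    rw [mem_ball, dist_eq_norm]
    have h1 : infDist (g₁ p x₁) K₁ ≤ ‖g₁ p x₁ - c₁‖ := by
      rw [← dist_eq_norm]; exact infDist_le_dist_of_mem hcK₁
    linarith [hnear₁ x hxR, hnear₁ x₁ hx₁R, norm_sub_le_norm_sub_add_norm_sub y (g₁ p x) c₁,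
      norm_sub_rev y (g₁ p x)]
  have hz_ball : z ∈ ball c₂ r := by
    rw [mem_ball, dist_eq_norm]
    linarith [hnear₂ x hxR, norm_sub_le_norm_sub_add_norm_sub z (g₂ p x) c₂,
      norm_sub_rev z (g₂ p x)]
  refine ⟨{
    p := p, x₁ := x₁, x := x, ρ := ρ, y := y, z := z, a := a, b := b
    ρ_pos := hρ, ρ_le := hρ1
    scale_pos := ht ▸ ht0
    scale_lt := ht ▸ htρ
    differentiableAt := hdiff xbar hxbarR
    fderiv_lt := (hsm p hpV xbar hxbarR).2.2.trans_le (min_le_left _ _)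
    zeta_lt := hpζ
    linearization := fun u hu u' hu' => hlin u (hsubR hu) u' (hsubR hu')
    penalized := fun u hu => ?_
    norm_sub_le := ht ▸ hxx₁
    x_mem := hxρ
    y_mem := hy.1
    z_mem := hz.1
    norm_sub_y_le := ?_
    norm_sub_z_le := ht ▸ hxz
    a_mem := regularNormalCone_inter_closedBall_subset hy_ball ha
    b_mem := regularNormalCone_inter_closedBall_subset hz_ball hb
    norm_a := hna
    norm_b_le := by linarith
    stationary := fun h => ?_ }⟩
  · have h1 := hpen' u hu
    have h2 := hdK₁ u (hsubR hu)
    have h3 : (L + 1) * κ * infDist (g₂ p u) K₂ ≤ ((L + 1) * κ + 4) * infDist (g₂ p u) C₂ :=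
      mul_le_mul (by linarith) (hdK₂ u (hsubR hu)) infDist_nonneg (by positivity)
    have h4 : infDist (g₁ p x₁) C₁ ≤ infDist (g₁ p x₁) K₁ :=
      infDist_le_infDist_of_subset Set.inter_subset_left ⟨c₁, hcK₁⟩
    linarith
  · rw [← hG, ← ht]
    linarith [hdK₁ x₁ hx₁R]
  · have h1 := hstat h
    rw [(hasFDerivAt_of_splitMap_fst hxdiff).fderiv,
      (hasFDerivAt_of_splitMap_snd hxdiff).fderiv] at h1
    change _ ≤ inner ℝ a (fderiv ℝ (G p) x h).fst + inner ℝ b (fderiv ℝ (G p) x h).snd at h1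
    have h2 : ‖fderiv ℝ (G p) x h - A h‖ ≤ δ * ‖h‖ := by
      rw [← _root_.sub_apply]
      refine (ContinuousLinearMap.le_opNorm _ _).trans ?_
      gcongr
      exact (hsm p hpV x hxR).2.2.le.trans (min_le_left _ _)
    have h3 : inner ℝ a (fderiv ℝ (G p) x h).fst - inner ℝ a (A h).fst ≤ 1 * (δ * ‖h‖) := by
      rw [← inner_sub_right]
      refine (real_inner_le_norm _ _).trans ?_
      rw [hna]
      gcongr
      exact (WithLp.norm_fst_le _ (fderiv ℝ (G p) x h - A h)).trans h2
    have h4 : inner ℝ b (fderiv ℝ (G p) x h).snd - inner ℝ b (A h).snd ≤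
        ((L + 1) * κ + 1) * (δ * ‖h‖) := by
      rw [← inner_sub_right]
      refine (real_inner_le_norm _ _).trans ?_
      gcongr
      exact (WithLp.norm_snd_le _ (fderiv ℝ (G p) x h - A h)).trans h2
    linarith

end ExistenceOfCriticalPoints

/-! ### Limits of normalized increments and subsequence extraction -/

section Limits

/-- Normalizing by `t` instead of the increment's own norm only rescales a nonzero limit by `‖v‖`,
and a zero limit lies in the cone by definition. Passing to a tail removes zero increments. -/
theorem mem_imageDerivative_of_tendsto {P E F : Type*}
    [NormedAddCommGroup E] [NormedSpace ℝ E] [NormedAddCommGroup F] [NormedSpace ℝ F]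
    {g : P → E → F} {ζ : P → ℝ} {pbar : P} {xbar : E} {p : ℕ → P} {t : ℕ → ℝ} {v : F}
    (ht : ∀ k, 0 < t k)
    (hp : ∀ k : ℕ, ‖g (p k) xbar - g pbar xbar‖ < 1 / ((k : ℝ) + 1) ∧
      DifferentiableAt ℝ (g (p k)) xbar ∧
      ‖fderiv ℝ (g (p k)) xbar - fderiv ℝ (g pbar) xbar‖ < 1 / ((k : ℝ) + 1) ∧
      |ζ (p k) - ζ pbar| < 1 / ((k : ℝ) + 1))
    (hv : Tendsto (fun k => (t k)⁻¹ • (g (p k) xbar - g pbar xbar)) atTop (𝓝 v)) :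
    v ∈ imageDerivative g ζ pbar xbar := by
  refine subset_closure ?_
  by_cases hv0 : v = 0
  · exact ⟨0, le_rfl, 0, Set.mem_insert _ _, by simp [hv0]⟩
  obtain ⟨N, hN⟩ := eventually_atTop.1 (hv.eventually_ne hv0)
  refine ⟨‖v‖, norm_nonneg _, ‖v‖⁻¹ • v, Set.mem_insert_of_mem _ ?_, ?_⟩
  · refine ⟨fun k => p (k + N), fun k => ?_, ?_⟩
    · have hne : g (p (k + N)) xbar - g pbar xbar ≠ 0 := fun h =>
        hN (k + N) (by omega) (by rw [h, smul_zero])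
      have hle : 1 / (((k + N : ℕ) : ℝ) + 1) ≤ 1 / ((k : ℝ) + 1) := by
        gcongr; omega
      obtain ⟨h1, h2, h3, h4⟩ := hp (k + N)
      exact ⟨norm_pos_iff.2 hne, h1.trans_le hle, h2, h3.trans_le hle, h4.trans_le hle⟩
    · have hlim := (tendsto_add_atTop_iff_nat N).2
        ((hv.norm.inv₀ (norm_ne_zero_iff.2 hv0)).smul hv)
      refine hlim.congr fun k => ?_
      have := ht (k + N)
      rw [norm_smul, Real.norm_eq_abs, abs_of_pos (inv_pos.2 this), mul_inv, inv_inv, smul_smul]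
      congr 1
      field_simp
  · rw [smul_smul, mul_inv_cancel₀ (norm_ne_zero_iff.2 hv0), one_smul]

theorem exists_subseq_tendsto_infDist_div {F : Type*} [PseudoMetricSpace F] {C : Set F}
    {q : ℕ → F} {t : ℕ → ℝ} (ht : ∀ k, 0 < t k)
    (h : liminf (fun k => infEDist (q k) C / ENNReal.ofReal (t k)) atTop = 0) :
    ∃ ψ : ℕ → ℕ, StrictMono ψ ∧
      Tendsto (fun k => infDist (q (ψ k)) C / t (ψ k)) atTop (𝓝 0) := by
  have hcl : MapClusterPt (0 : ℝ≥0∞) atTop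
      (fun k => infEDist (q k) C / ENNReal.ofReal (t k)) := by
    refine ENNReal.nhds_zero_basis.mapClusterPt_iff_frequently.2 fun ε hε => ?_
    have hfreq : ∃ᶠ k in atTop, infEDist (q k) C / ENNReal.ofReal (t k) < ε :=
      frequently_lt_of_liminf_lt (by isBoundedDefault) (by rwa [h])
    exact hfreq
  obtain ⟨ψ, hψ, hlim⟩ := hcl.tendsto_subseq
  refine ⟨ψ, hψ, ?_⟩
  have h1 := (ENNReal.tendsto_toReal ENNReal.zero_ne_top).comp hlim
  rw [ENNReal.toReal_zero] at h1
  refine h1.congr fun k => ?_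
  simp only [Function.comp_apply, ENNReal.toReal_div, ENNReal.toReal_ofReal (ht _).le]
  rfl

end Limits

/-! ### Rescaled estimates at an approximate critical point -/

namespace ApproxCriticalPoint

variable {P E F₁ F₂ : Type*}
  [NormedAddCommGroup E] [InnerProductSpace ℝ E]
  [NormedAddCommGroup F₁] [InnerProductSpace ℝ F₁]
  [NormedAddCommGroup F₂] [InnerProductSpace ℝ F₂]
  {g₁ : P → E → F₁} {g₂ : P → E → F₂} {C₁ : Set F₁} {C₂ : Set F₂} {ζ : P → ℝ}
  {pbar : P} {xbar : E} {M δ : ℝ}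

/-- The size of the displacement of the critical point. -/
noncomputable def scale (D : ApproxCriticalPoint g₁ g₂ C₁ C₂ ζ pbar xbar M δ) : ℝ :=
  ‖D.x₁ - xbar‖ + ‖splitMap g₁ g₂ D.p xbar - splitMap g₁ g₂ pbar xbar‖

/-- The normalized displacement in the parameter. -/
noncomputable def direction (D : ApproxCriticalPoint g₁ g₂ C₁ C₂ ζ pbar xbar M δ) : WithLp 2 (F₁ × F₂) :=
  D.scale⁻¹ • (splitMap g₁ g₂ D.p xbar - splitMap g₁ g₂ pbar xbar)

/-- The normalized displacement in the decision variable. -/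
noncomputable def displacement (D : ApproxCriticalPoint g₁ g₂ C₁ C₂ ζ pbar xbar M δ) : E :=
  D.scale⁻¹ • (D.x₁ - xbar)

/-- The normalized displacement of the points of the constraint sets. -/
noncomputable def image (D : ApproxCriticalPoint g₁ g₂ C₁ C₂ ζ pbar xbar M δ) : WithLp 2 (F₁ × F₂) :=
  D.scale⁻¹ • (WithLp.toLp 2 (D.y, D.z) - splitMap g₁ g₂ pbar xbar)

variable (D : ApproxCriticalPoint g₁ g₂ C₁ C₂ ζ pbar xbar M δ)

theorem scale_pos' : 0 < D.scale := D.scale_pos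

theorem norm_displacement_add_norm_direction : ‖D.displacement‖ + ‖D.direction‖ = 1 := by
  have h := D.scale_pos'
  rw [displacement, direction, norm_smul, norm_smul, ← mul_add, Real.norm_eq_abs,
    abs_of_pos (inv_pos.2 h)]
  exact inv_mul_cancel₀ h.ne'

theorem norm_displacement_le : ‖D.displacement‖ ≤ 1 := by
  linarith [D.norm_displacement_add_norm_direction, norm_nonneg D.direction]

theorem norm_direction_le : ‖D.direction‖ ≤ 1 := by
  linarith [D.norm_displacement_add_norm_direction, norm_nonneg D.displacement]

theorem scale_lt_self (hδ : 0 < δ) : D.scale < δ :=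
  D.scale_lt.trans_le (mul_le_of_le_one_right hδ.le D.ρ_le)

theorem norm_x_sub_le (hδ1 : δ ≤ 1) : ‖D.x - xbar‖ ≤ 2 * D.scale := by
  have h1 : ‖D.x - D.x₁‖ ≤ D.scale :=
    D.norm_sub_le.trans (mul_le_of_le_one_left D.scale_pos'.le hδ1)
  have h2 : ‖D.x₁ - xbar‖ ≤ D.scale := le_add_of_nonneg_right (norm_nonneg _)
  linarith [norm_sub_le_norm_sub_add_norm_sub D.x D.x₁ xbar]

theorem norm_increment_sub_le (hδ : 0 < δ) (hδ1 : δ ≤ 1) :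
    ‖splitMap g₁ g₂ D.p D.x - splitMap g₁ g₂ pbar xbar -
      D.scale • (D.direction + fderiv ℝ (splitMap g₁ g₂ pbar) xbar D.displacement)‖ ≤
      (2 + ‖fderiv ℝ (splitMap g₁ g₂ pbar) xbar‖) * δ * D.scale := by
  set A := fderiv ℝ (splitMap g₁ g₂ pbar) xbar
  have h := D.scale_pos'
  have e : splitMap g₁ g₂ D.p D.x - splitMap g₁ g₂ pbar xbar -
      D.scale • (D.direction + A D.displacement) =
      (splitMap g₁ g₂ D.p D.x - splitMap g₁ g₂ D.p xbar - A (D.x - xbar)) + A (D.x - D.x₁) := by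
    rw [direction, displacement, map_smul, ← smul_add, smul_inv_smul₀ h.ne']
    simp only [map_sub]
    abel
  rw [e]
  have h1 := D.linearization D.x D.x_mem xbar (mem_closedBall_self D.ρ_pos.le)
  have h2 : δ * ‖D.x - xbar‖ ≤ δ * (2 * D.scale) := by gcongr; exact D.norm_x_sub_le hδ1
  have h3 : ‖A (D.x - D.x₁)‖ ≤ ‖A‖ * (δ * D.scale) :=
    (A.le_opNorm _).trans (by gcongr; exact D.norm_sub_le)
  linarith [norm_add_le (splitMap g₁ g₂ D.p D.x - splitMap g₁ g₂ D.p xbar - A (D.x - xbar))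
    (A (D.x - D.x₁))]

/-- `z` is within `δ * scale` of `g₂ p x`, but `y` only within that plus the distance of `g₁ p x₁`
to `C₁`. That distance is the one error term not yet known to be small. -/
theorem norm_image_sub_le (hδ : 0 < δ) (hδ1 : δ ≤ 1) :
    ‖D.image - (D.direction + fderiv ℝ (splitMap g₁ g₂ pbar) xbar D.displacement)‖ ≤
      infDist (g₁ D.p D.x₁) C₁ / D.scale +
        (4 + ‖fderiv ℝ (splitMap g₁ g₂ pbar) xbar‖) * δ := by
  have h := D.scale_pos'
  have h1 := D.norm_increment_sub_le hδ hδ1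
  set W := D.direction + fderiv ℝ (splitMap g₁ g₂ pbar) xbar D.displacement
  have hprod : ∀ w : WithLp 2 (F₁ × F₂), ‖w‖ ≤ ‖w.fst‖ + ‖w.snd‖ := fun w => by
    refine (sq_le_sq₀ (norm_nonneg _) (by positivity)).1 ?_
    rw [WithLp.prod_norm_sq_eq_of_L2, add_sq]
    linarith [mul_nonneg (norm_nonneg w.fst) (norm_nonneg w.snd)]
  have h2 : ‖WithLp.toLp 2 (D.y, D.z) - splitMap g₁ g₂ D.p D.x‖ ≤
      infDist (g₁ D.p D.x₁) C₁ + 2 * δ * D.scale := by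
    have h3 : ‖D.y - g₁ D.p D.x‖ ≤ infDist (g₁ D.p D.x₁) C₁ + δ * D.scale := by
      rw [norm_sub_rev]; exact D.norm_sub_y_le
    have h4 : ‖D.z - g₂ D.p D.x‖ ≤ δ * D.scale := by
      rw [norm_sub_rev]; exact D.norm_sub_z_le
    refine (hprod _).trans ?_
    change ‖D.y - g₁ D.p D.x‖ + ‖D.z - g₂ D.p D.x‖ ≤ _
    linarith
  have h5 : ‖WithLp.toLp 2 (D.y, D.z) - splitMap g₁ g₂ pbar xbar - D.scale • W‖ ≤
      infDist (g₁ D.p D.x₁) C₁ +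
        (4 + ‖fderiv ℝ (splitMap g₁ g₂ pbar) xbar‖) * δ * D.scale := by
    have h6 := norm_add_le (WithLp.toLp 2 (D.y, D.z) - splitMap g₁ g₂ D.p D.x)
      (splitMap g₁ g₂ D.p D.x - splitMap g₁ g₂ pbar xbar - D.scale • W)
    rw [← add_sub_assoc, sub_add_sub_cancel] at h6
    linarith
  have h7 : D.image - W =
      D.scale⁻¹ • (WithLp.toLp 2 (D.y, D.z) - splitMap g₁ g₂ pbar xbar - D.scale • W) := by
    rw [image, smul_sub _ _ (D.scale • W), inv_smul_smul₀ h.ne']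
  rw [h7, norm_smul, Real.norm_eq_abs, abs_of_pos (inv_pos.2 h), inv_mul_le_iff₀ h]
  refine h5.trans_eq ?_
  field_simp

theorem add_scale_smul_image :
    splitMap g₁ g₂ pbar xbar + D.scale • D.image = WithLp.toLp 2 (D.y, D.z) := by
  rw [image, smul_inv_smul₀ D.scale_pos'.ne']
  abel

/-- Feasibility of the direction `v + A u` up to `o(t)` controls the distance of `g₁` to `C₁`. -/
theorem infDist_div_scale_le (hM : 0 ≤ M) (hδ : 0 < δ)
    (hfeas : splitMap g₁ g₂ pbar xbar ∈ splitSet C₁ C₂) (v : WithLp 2 (F₁ × F₂)) (u : E)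
    (hu : δ * ‖u‖ ≤ 1) :
    infDist (g₁ D.p D.x₁) C₁ / D.scale ≤ (1 + M) * (infDist (splitMap g₁ g₂ pbar xbar +
      D.scale • (v + fderiv ℝ (splitMap g₁ g₂ pbar) xbar u)) (splitSet C₁ C₂) / D.scale +
        δ * ‖u‖ + ‖D.direction - v‖) + δ * (‖u‖ + 1) := by
  have h := D.scale_pos'
  set A := fderiv ℝ (splitMap g₁ g₂ pbar) xbar
  set q := splitMap g₁ g₂ pbar xbar + D.scale • (v + A u)
  -- The competitor for `penalized`; `scale_lt` and `hu` together keep it inside the `ρ`-ball.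
  set X := xbar + D.scale • u
  have hXsub : X - xbar = D.scale • u := by simp [X]
  have hXnorm : ‖X - xbar‖ = D.scale * ‖u‖ := by
    rw [hXsub, norm_smul, Real.norm_eq_abs, abs_of_pos h]
  have hX : X ∈ closedBall xbar D.ρ := by
    rw [mem_closedBall, dist_eq_norm, hXnorm]
    calc D.scale * ‖u‖ ≤ δ * D.ρ * ‖u‖ := by gcongr; exact D.scale_lt.le
      _ = δ * ‖u‖ * D.ρ := by ring
      _ ≤ D.ρ := mul_le_of_le_one_left D.ρ_pos.le hu
  have h1 := D.linearization X hX xbar (mem_closedBall_self D.ρ_pos.le)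
  rw [hXnorm, hXsub] at h1
  have h2 : ‖splitMap g₁ g₂ D.p X - q‖ ≤ δ * (D.scale * ‖u‖) + D.scale * ‖D.direction - v‖ := by
    have e : splitMap g₁ g₂ D.p X - q =
        (splitMap g₁ g₂ D.p X - splitMap g₁ g₂ D.p xbar - A (D.scale • u)) +
          D.scale • (D.direction - v) := by
      rw [smul_sub, direction, smul_inv_smul₀ h.ne', map_smul]
      simp only [q, smul_add]
      abel
    rw [e]
    refine (norm_add_le _ _).trans (add_le_add h1 ?_)
    rw [norm_smul, Real.norm_eq_abs, abs_of_pos h]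
  have h3 : infDist (splitMap g₁ g₂ D.p X) (splitSet C₁ C₂) ≤
      infDist q (splitSet C₁ C₂) + (δ * (D.scale * ‖u‖) + D.scale * ‖D.direction - v‖) := by
    have := infDist_le_infDist_add_dist (s := splitSet C₁ C₂) (x := splitMap g₁ g₂ D.p X) (y := q)
    rw [dist_eq_norm] at this
    linarith
  have h4 : infDist (g₁ D.p X) C₁ ≤ infDist (splitMap g₁ g₂ D.p X) (splitSet C₁ C₂) :=
    infDist_fst_le_infDist_splitSet (q := splitMap g₁ g₂ D.p X) hfeas
  have h5 : infDist (g₂ D.p X) C₂ ≤ infDist (splitMap g₁ g₂ D.p X) (splitSet C₁ C₂) :=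
    infDist_snd_le_infDist_splitSet (q := splitMap g₁ g₂ D.p X) hfeas
  have h6 : ‖X - D.x₁‖ ≤ D.scale * (‖u‖ + 1) := by
    have h7 : ‖D.x₁ - xbar‖ ≤ D.scale := le_add_of_nonneg_right (norm_nonneg _)
    linarith [norm_sub_le_norm_sub_add_norm_sub X xbar D.x₁, norm_sub_rev xbar D.x₁]
  have h8 := D.penalized X hX
  have h9 : M * infDist (g₂ D.p X) C₂ ≤ M * (infDist q (splitSet C₁ C₂) +
      (δ * (D.scale * ‖u‖) + D.scale * ‖D.direction - v‖)) := by
    gcongr; exact h5.trans h3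
  have h10 : δ * ‖X - D.x₁‖ ≤ δ * (D.scale * (‖u‖ + 1)) := by gcongr
  rw [div_le_iff₀ h]
  have e : ((1 + M) * (infDist q (splitSet C₁ C₂) / D.scale + δ * ‖u‖ + ‖D.direction - v‖) +
      δ * (‖u‖ + 1)) * D.scale = (1 + M) * (infDist q (splitSet C₁ C₂) +
      (δ * (D.scale * ‖u‖) + D.scale * ‖D.direction - v‖)) + δ * (D.scale * (‖u‖ + 1)) := by
    field_simp
    ring
  rw [e]
  linarith

end ApproxCriticalPoint

/-! ### Passage to the limit and the contradiction -/

section MainResult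

variable {P E F₁ F₂ : Type*} [TopologicalSpace P]
  [NormedAddCommGroup E] [InnerProductSpace ℝ E] [FiniteDimensional ℝ E]
  [NormedAddCommGroup F₁] [InnerProductSpace ℝ F₁] [FiniteDimensional ℝ F₁]
  [NormedAddCommGroup F₂] [InnerProductSpace ℝ F₂] [FiniteDimensional ℝ F₂]

/-- A one-sided bound in the limit, applied to `d` and `-d`, forces equality. -/
theorem adjoint_apply_limit_eq_zero {F : Type*} [NormedAddCommGroup F] [InnerProductSpace ℝ F]
    [CompleteSpace F] {A : E →L[ℝ] F} {lam : ℕ → F} {l : F} {ε : ℕ → ℝ}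
    (hlam : Tendsto lam atTop (𝓝 l)) (hε : Tendsto ε atTop (𝓝 0))
    (h : ∀ k d, -(ε k * ‖d‖) ≤ inner ℝ (lam k) (A d)) :
    ContinuousLinearMap.adjoint A l = 0 := by
  have hnonneg : ∀ d, 0 ≤ inner ℝ l (A d) := fun d => by
    refine le_of_tendsto_of_tendsto' ?_ (hlam.inner tendsto_const_nhds) fun k => h k d
    simpa using (hε.mul_const ‖d‖).neg
  refine ext_inner_right ℝ fun d => ?_
  rw [ContinuousLinearMap.adjoint_inner_left, inner_zero_left]
  refine le_antisymm ?_ (hnonneg d)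
  have := hnonneg (-d)
  rw [map_neg, inner_neg_right] at this
  linarith

theorem robinsonStable_splitMap
    (g₁ : P → E → F₁) (g₂ : P → E → F₂) (C₁ : Set F₁) (C₂ : Set F₂) (pbar : P) (xbar : E)
    (hfeas : xbar ∈ solutionMap (splitMap g₁ g₂) (splitSet C₁ C₂) pbar)
    (hC₁ : LocallyClosedAround C₁ (g₁ pbar xbar))
    (hC₂ : LocallyClosedAround C₂ (g₂ pbar xbar))
    (hg : PartiallySmoothAt (splitMap g₁ g₂) pbar xbar)
    (ζ : P → ℝ) (hζ : ContinuousAt ζ pbar)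
    (hdir : ∀ v ∈ imageDerivative (splitMap g₁ g₂) ζ pbar xbar,
      ∀ t : ℕ → ℝ, DecreasesToZero t →
        ∃ u : E,
          liminf (fun k => Metric.infEDist
            (splitMap g₁ g₂ pbar xbar
              + t k • (v + fderiv ℝ (splitMap g₁ g₂ pbar) xbar u))
            (splitSet C₁ C₂) / ENNReal.ofReal (t k)) atTop = 0)
    (hRS : RobinsonStable g₂ C₂ pbar xbar)
    (hreg : ∀ v ∈ imageDerivative (splitMap g₁ g₂) ζ pbar xbar,
      ∀ u : E, (v, u) ≠ (0, 0) →
        v + fderiv ℝ (splitMap g₁ g₂ pbar) xbar u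
          ∈ contingentCone (splitSet C₁ C₂) (splitMap g₁ g₂ pbar xbar) →
        ∀ lam : WithLp 2 (F₁ × F₂),
          lam.fst ∈ directionalNormalCone C₁ (g₁ pbar xbar)
            (v.fst + fderiv ℝ (g₁ pbar) xbar u) →
          lam.snd ∈ directionalNormalCone C₂ (g₂ pbar xbar)
            (v.snd + fderiv ℝ (g₂ pbar) xbar u) →
          ContinuousLinearMap.adjoint (fderiv ℝ (splitMap g₁ g₂ pbar) xbar) lam = 0 →
          lam.fst = 0) :
    RobinsonStable (splitMap g₁ g₂) (splitSet C₁ C₂) pbar xbar := by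
  by_contra hnot
  obtain ⟨M, hM, hdata⟩ := exists_approxCriticalPoint hfeas hC₁ hC₂ hg hζ hRS hnot
  have hfeas' : splitMap g₁ g₂ pbar xbar ∈ splitSet C₁ C₂ := hfeas
  have hδ : ∀ k : ℕ, 0 < 1 / ((k : ℝ) + 1) := fun k => by positivity
  have hδ1 : ∀ k : ℕ, 1 / ((k : ℝ) + 1) ≤ 1 := fun k => by
    rw [div_le_one (by positivity)]; linarith [k.cast_nonneg (α := ℝ)]
  have hδlim : Tendsto (fun k : ℕ => 1 / ((k : ℝ) + 1)) atTop (𝓝 0) :=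
    tendsto_one_div_add_atTop_nhds_zero_nat
  let D : ∀ k : ℕ, ApproxCriticalPoint g₁ g₂ C₁ C₂ ζ pbar xbar M (1 / ((k : ℝ) + 1)) :=
    fun k => (hdata _ (hδ k) (hδ1 k)).some
  have hcomp : IsCompact (closedBall (0 : E) 1 ×ˢ closedBall (0 : WithLp 2 (F₁ × F₂)) 1 ×ˢ
      closedBall (0 : F₁) 1 ×ˢ closedBall (0 : F₂) M) :=
    (isCompact_closedBall _ _).prod ((isCompact_closedBall _ _).prod
      ((isCompact_closedBall _ _).prod (isCompact_closedBall _ _)))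
  obtain ⟨⟨u, v, a, b⟩, -, φ, hφ, hlim⟩ := hcomp.tendsto_subseq
    (x := fun k => ((D k).displacement, (D k).direction, (D k).a, (D k).b)) fun k => by
      simp only [Set.mem_prod, mem_closedBall_zero_iff]
      exact ⟨(D k).norm_displacement_le, (D k).norm_direction_le, (D k).norm_a.le,
        (D k).norm_b_le⟩
  have hlim_u : Tendsto (fun k => (D (φ k)).displacement) atTop (𝓝 u) :=
    (continuous_fst.tendsto _).comp hlim
  have hlim_v : Tendsto (fun k => (D (φ k)).direction) atTop (𝓝 v) :=
    ((continuous_fst.comp continuous_snd).tendsto _).comp hlim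
  have hlim_a : Tendsto (fun k => (D (φ k)).a) atTop (𝓝 a) :=
    ((continuous_fst.comp (continuous_snd.comp continuous_snd)).tendsto _).comp hlim
  have hlim_b : Tendsto (fun k => (D (φ k)).b) atTop (𝓝 b) :=
    ((continuous_snd.comp (continuous_snd.comp continuous_snd)).tendsto _).comp hlim
  have hmono : ∀ k, 1 / ((φ k : ℝ) + 1) ≤ 1 / ((k : ℝ) + 1) := fun k => by
    gcongr; exact hφ.id_le k
  have ht : DecreasesToZero fun k => (D (φ k)).scale :=
    ⟨fun k => (D (φ k)).scale_pos', squeeze_zero (fun k => (D (φ k)).scale_pos'.le)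
      (fun k => ((D (φ k)).scale_lt_self (hδ _)).le) (hδlim.comp hφ.tendsto_atTop)⟩
  have hv : v ∈ imageDerivative (splitMap g₁ g₂) ζ pbar xbar := by
    refine mem_imageDerivative_of_tendsto (p := fun k => (D (φ k)).p) ht.1 (fun k => ?_) hlim_v
    refine ⟨?_, (D (φ k)).differentiableAt, (D (φ k)).fderiv_lt.trans_le (hmono k),
      (D (φ k)).zeta_lt.trans_le (hmono k)⟩
    have h1 := (D (φ k)).scale_lt_self (hδ _)
    have h2 : ‖splitMap g₁ g₂ (D (φ k)).p xbar - splitMap g₁ g₂ pbar xbar‖ ≤ (D (φ k)).scale :=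
      le_add_of_nonneg_left (norm_nonneg _)
    exact (h2.trans_lt h1).trans_le (hmono k)
  -- `u'` depends on the sequence of scales and need not equal `u`; it only bounds the distance to
  -- `C₁`. The `liminf` is attained along a further subsequence `ψ`.
  obtain ⟨u', hu'⟩ := hdir v hv _ ht
  obtain ⟨ψ, hψ, hψlim⟩ := exists_subseq_tendsto_infDist_div ht.1 hu'
  have hθ : Tendsto (fun k => φ (ψ k)) atTop atTop := hφ.tendsto_atTop.comp hψ.tendsto_atTop
  replace hlim_u := hlim_u.comp hψ.tendsto_atTop
  replace hlim_v := hlim_v.comp hψ.tendsto_atTop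
  replace hlim_a := hlim_a.comp hψ.tendsto_atTop
  replace hlim_b := hlim_b.comp hψ.tendsto_atTop
  replace ht : DecreasesToZero fun k => (D (φ (ψ k))).scale :=
    ⟨fun k => ht.1 _, ht.2.comp hψ.tendsto_atTop⟩
  have hδθ := hδlim.comp hθ
  simp only [Function.comp_def] at hlim_u hlim_v hlim_a hlim_b hδθ
  set A := fderiv ℝ (splitMap g₁ g₂ pbar) xbar with hA
  have hgap : Tendsto (fun k => infDist (g₁ (D (φ (ψ k))).p (D (φ (ψ k))).x₁) C₁ /
      (D (φ (ψ k))).scale) atTop (𝓝 0) := by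
    have hupper : Tendsto (fun k => (1 + M) * (infDist (splitMap g₁ g₂ pbar xbar +
        (D (φ (ψ k))).scale • (v + A u')) (splitSet C₁ C₂) / (D (φ (ψ k))).scale +
        1 / ((φ (ψ k) : ℝ) + 1) * ‖u'‖ + ‖(D (φ (ψ k))).direction - v‖) +
        1 / ((φ (ψ k) : ℝ) + 1) * (‖u'‖ + 1)) atTop (𝓝 0) := by
      have h1 := (hlim_v.sub_const v).norm
      have h2 := (((hψlim.add (hδθ.mul_const ‖u'‖)).add h1).const_mul (1 + M)).add
        (hδθ.mul_const (‖u'‖ + 1))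
      simpa using h2
    have hsmall : ∀ᶠ k in atTop, 1 / ((φ (ψ k) : ℝ) + 1) * ‖u'‖ ≤ 1 := by
      have := hδθ.mul_const ‖u'‖
      rw [zero_mul] at this
      exact this.eventually_le_const one_pos
    refine tendsto_of_tendsto_of_tendsto_of_le_of_le' tendsto_const_nhds hupper
      (.of_forall fun k => div_nonneg infDist_nonneg (ht.1 k).le) ?_
    filter_upwards [hsmall] with k hk
    exact (D (φ (ψ k))).infDist_div_scale_le hM (hδ _) hfeas' v u' hk
  have himage : Tendsto (fun k => (D (φ (ψ k))).image) atTop (𝓝 (v + A u)) := by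
    have h1 : Tendsto (fun k => (D (φ (ψ k))).direction + A (D (φ (ψ k))).displacement) atTop
        (𝓝 (v + A u)) := hlim_v.add ((A.continuous.tendsto u).comp hlim_u)
    have h2 : Tendsto (fun k => (D (φ (ψ k))).image -
        ((D (φ (ψ k))).direction + A (D (φ (ψ k))).displacement)) atTop (𝓝 0) := by
      refine squeeze_zero_norm (fun k => (D (φ (ψ k))).norm_image_sub_le (hδ _) (hδ1 _)) ?_
      simpa using hgap.add (hδθ.const_mul (4 + ‖A‖))
    simpa using h2.add h1
  have hfst : Tendsto (fun k => (D (φ (ψ k))).image.fst) atTop (𝓝 (v + A u).fst) :=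
    ((WithLp.fstL 2 ℝ F₁ F₂).continuous.tendsto _).comp himage
  have hsnd : Tendsto (fun k => (D (φ (ψ k))).image.snd) atTop (𝓝 (v + A u).snd) :=
    ((WithLp.sndL 2 ℝ F₁ F₂).continuous.tendsto _).comp himage
  have hdiff : DifferentiableAt ℝ (splitMap g₁ g₂ pbar) xbar := by
    obtain ⟨R, hR, V, hV, hsm⟩ := hg.exists_closedBall one_pos
    exact (hsm pbar (mem_of_mem_nhds hV) xbar (mem_closedBall_self hR.le)).1
  have hA₁ : fderiv ℝ (g₁ pbar) xbar u = (A u).fst := by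
    rw [(hasFDerivAt_of_splitMap_fst hdiff).fderiv]; rfl
  have hA₂ : fderiv ℝ (g₂ pbar) xbar u = (A u).snd := by
    rw [(hasFDerivAt_of_splitMap_snd hdiff).fderiv]; rfl
  have hy : ∀ k, g₁ pbar xbar + (D (φ (ψ k))).scale • (D (φ (ψ k))).image.fst =
      (D (φ (ψ k))).y := fun k => congrArg WithLp.fst (D (φ (ψ k))).add_scale_smul_image
  have hz : ∀ k, g₂ pbar xbar + (D (φ (ψ k))).scale • (D (φ (ψ k))).image.snd =
      (D (φ (ψ k))).z := fun k => congrArg WithLp.snd (D (φ (ψ k))).add_scale_smul_image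
  have hlam : Tendsto (fun k => WithLp.toLp 2 ((D (φ (ψ k))).a, (D (φ (ψ k))).b)) atTop
      (𝓝 (WithLp.toLp 2 (a, b))) :=
    ((WithLp.prod_continuous_toLp 2 F₁ F₂).tendsto _).comp (hlim_a.prodMk_nhds hlim_b)
  have ha : a = 0 := by
    refine hreg v hv u ?_ ⟨_, _, ht, himage, fun k => ?_⟩ (WithLp.toLp 2 (a, b)) ?_ ?_ ?_
    -- The two normalized displacements have norms summing to one, so their limits cannot both
    -- vanish.
    · intro h0
      obtain ⟨hv0, hu0⟩ := Prod.mk.inj h0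
      have h1 := hlim_u.norm.add hlim_v.norm
      simp only [ApproxCriticalPoint.norm_displacement_add_norm_direction, hv0, hu0, norm_zero,
        add_zero] at h1
      exact one_ne_zero (tendsto_nhds_unique tendsto_const_nhds h1)
    · rw [(D (φ (ψ k))).add_scale_smul_image]
      exact ⟨(D (φ (ψ k))).y_mem, (D (φ (ψ k))).z_mem⟩
    · rw [hA₁]
      refine ⟨_, _, _, ht, hfst, hlim_a, fun k => ?_⟩
      rw [hy]
      exact ⟨(D (φ (ψ k))).y_mem, (D (φ (ψ k))).a_mem⟩
    · rw [hA₂]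
      refine ⟨_, _, _, ht, hsnd, hlim_b, fun k => ?_⟩
      rw [hz]
      exact ⟨(D (φ (ψ k))).z_mem, (D (φ (ψ k))).b_mem⟩
    · refine adjoint_apply_limit_eq_zero hlam (ε := fun k => M * (1 / ((φ (ψ k) : ℝ) + 1)))
        (by simpa using hδθ.const_mul M) fun k d => ?_
      rw [WithLp.prod_inner_apply]
      exact (D (φ (ψ k))).stationary d
  have hnorm := hlim_a.norm
  simp only [ApproxCriticalPoint.norm_a, ha, norm_zero] at hnorm
  exact one_ne_zero (tendsto_nhds_unique tendsto_const_nhds hnorm)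

end MainResult

theorem theorem3p5 {P : Type*} [TopologicalSpace P] (n l₁ l₂ : ℕ)
    (g₁ : P → EuclideanSpace ℝ (Fin n) → EuclideanSpace ℝ (Fin l₁))
    (g₂ : P → EuclideanSpace ℝ (Fin n) → EuclideanSpace ℝ (Fin l₂))
    (C₁ : Set (EuclideanSpace ℝ (Fin l₁))) (C₂ : Set (EuclideanSpace ℝ (Fin l₂)))
    (pbar : P) (xbar : EuclideanSpace ℝ (Fin n))
    (hfeas : xbar ∈ solutionMap (splitMap g₁ g₂) (splitSet C₁ C₂) pbar)
    (hC₁ : LocallyClosedAround C₁ (g₁ pbar xbar))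
    (hC₂ : LocallyClosedAround C₂ (g₂ pbar xbar))
    (hg : PartiallySmoothAt (splitMap g₁ g₂) pbar xbar)
    (ζ : P → ℝ) (hζ : ContinuousAt ζ pbar)
    (hdir : ∀ v ∈ imageDerivative (splitMap g₁ g₂) ζ pbar xbar,
      ∀ t : ℕ → ℝ, DecreasesToZero t →
        ∃ u : EuclideanSpace ℝ (Fin n),
          liminf (fun k => Metric.infEDist
            (splitMap g₁ g₂ pbar xbar
              + t k • (v + fderiv ℝ (splitMap g₁ g₂ pbar) xbar u))
            (splitSet C₁ C₂) / ENNReal.ofReal (t k)) atTop = 0)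
    (hRS : RobinsonStable g₂ C₂ pbar xbar)
    (hreg : ∀ v ∈ imageDerivative (splitMap g₁ g₂) ζ pbar xbar,
      ∀ u : EuclideanSpace ℝ (Fin n), (v, u) ≠ (0, 0) →
        v + fderiv ℝ (splitMap g₁ g₂ pbar) xbar u
          ∈ contingentCone (splitSet C₁ C₂) (splitMap g₁ g₂ pbar xbar) →
        ∀ lam : WithLp 2 (EuclideanSpace ℝ (Fin l₁) × EuclideanSpace ℝ (Fin l₂)),
          lam.fst ∈ directionalNormalCone C₁ (g₁ pbar xbar)
            (v.fst + fderiv ℝ (g₁ pbar) xbar u) →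
          lam.snd ∈ directionalNormalCone C₂ (g₂ pbar xbar)
            (v.snd + fderiv ℝ (g₂ pbar) xbar u) →
          ContinuousLinearMap.adjoint (fderiv ℝ (splitMap g₁ g₂ pbar) xbar) lam = 0 →
          lam.fst = 0) :
    RobinsonStable (splitMap g₁ g₂) (splitSet C₁ C₂) pbar xbar :=
  robinsonStable_splitMap g₁ g₂ C₁ C₂ pbar xbar hfeas hC₁ hC₂ hg ζ hζ hdir hRS hreg
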